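/- Let $\varphi:(0,\infty)\to(0,\infty)$ be quasi-concave, i.e. $\varphi$ is increasing and $\varphi(t)/t$ is decreasing, and suppose that there is a constant $C_0>0$ with $$\varphi(t)\ \ge\ C_0\,t\log(1+1/t)\qquad\text{for all }t>0 .$$ Let $\Lambda_\varphi$ be the minimal Lorentz space of all measurable $f$ on $(0,\infty)$ with $\|f\|_{\Lambda_\varphi}=\int_{[0,\infty)} f^*(t)\,d\varphi(t)<\infty$, where $f^*$ is the decreasing rearrangement of $f$ and $\varphi(0)=0$ (so that $d\varphi$ has mass $\varphi(0+)$ at $0$). Let $Sf(t)=\frac1t\int_0^t f(r)\,dr$ be the Hardy operator, and let $\mathfrak R[S,\Lambda_\varphi]$ be the minimal rearrangement invariant Banach function space $Y$ on $(0,\infty)$ (in the sense of Bennett and Sharpley, given by a rearrangement invariant function norm with the Fatou property) such that $S:\Lambda_\varphi\to Y$ is bounded; that is, $S:\Lambda_\varphi\to Y$ is bounded, and $Y\subset Z$ for every rearrangement invariant Banach function space $Z$ such that $S:\Lambda_\varphi\to Z$ is bounded. Put $$\tilde\varphi(t)=\inf_{r>0}\frac{t\,\varphi(r)}{r\log(1+t/r)},\qquad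 t>0 .$$ Then the space $\mathfrak R[S,\Lambda_\varphi]$ exists, and its fundamental function is equivalent to $\tilde\varphi$: there are constants $c,C>0$ such that $$c\,\tilde\varphi(t)\ \le\ \|\chi_{(0,t)}\|_{\mathfrak R[S,\Lambda_\varphi]}\ \le\ C\,\tilde\varphi(t)\qquad\text{for all }t>0 .$$ (The space is determined up to equivalence of norms; the constants may depend on $\varphi$ and on the choice of the norm.) -/

import Mathlib

open MeasureTheory Set
open scoped ENNReal NNReal

noncomputable section

/-- Lebesgue measure on `(0, ∞)`, seen as a measure on `ℝ`. Functions on `(0, ∞)` are represented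
by functions on `ℝ`, whose values outside `(0, ∞)` never matter. -/
abbrev halfLine : Measure ℝ := volume.restrict (Ioi 0)

/-- Quasi-concave functions on `(0, ∞)`: positive, increasing, and with `φ(t)/t` decreasing. No
value at `0` is prescribed; `φ(0+)` may be positive, as for `φ(t) = max {1, t}`. -/
structure QuasiConcave (φ : ℝ → ℝ) : Prop where
  pos : ∀ t, 0 < t → 0 < φ t
  mono : MonotoneOn φ (Ioi 0)
  anti : AntitoneOn (fun t => φ t / t) (Ioi 0)

/-- The extension of `φ` by `0` to `(-∞, 0]`. -/
def extendZero (φ : ℝ → ℝ) (t : ℝ) : ℝ := if t ≤ 0 then 0 else φ t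

theorem QuasiConcave.monotone_extendZero {φ : ℝ → ℝ} (hφ : QuasiConcave φ) :
    Monotone (extendZero φ) := by
  intro a b hab
  unfold extendZero
  split_ifs with h1 h2 h2
  · exact le_rfl
  · exact (hφ.pos b (not_le.mp h2)).le
  · exact absurd (hab.trans h2) h1
  · exact hφ.mono (not_le.mp h1) (not_le.mp h2) hab

/-- The Lebesgue-Stieltjes measure `dφ` on `[0, ∞)`, where `φ(0) = 0`: it has mass `φ(0+)` at the
point `0`, and mass `φ(b) - φ(a)` on `(a, b]` for `0 < a ≤ b`. -/
def QuasiConcave.stieltjesMeasure {φ : ℝ → ℝ} (hφ : QuasiConcave φ) : Measure ℝ :=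
  hφ.monotone_extendZero.stieltjesFunction.measure

/-- The decreasing rearrangement `f^*(t) = inf {s ≥ 0 : |{x > 0 : |f x| > s}| ≤ t}`, `t ≥ 0`
(so `f^*(0) = f^*(0+) = ‖f‖_∞`). -/
def decRearr (f : ℝ → ℝ) (t : ℝ) : ℝ≥0∞ :=
  sInf {s : ℝ≥0∞ | halfLine {x | s < ‖f x‖ₑ} ≤ ENNReal.ofReal t}

/-- The functional `‖f‖_{Λ_φ} = ∫_{[0, ∞)} f^*(t) dφ(t)`. -/
def QuasiConcave.lorentzNorm {φ : ℝ → ℝ} (hφ : QuasiConcave φ) (f : ℝ → ℝ) : ℝ≥0∞ :=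
  ∫⁻ t in Ici 0, decRearr f t ∂hφ.stieltjesMeasure

/-- The minimal Lorentz space `Λ_φ`. -/
def QuasiConcave.lorentzSpace {φ : ℝ → ℝ} (hφ : QuasiConcave φ) : Set (ℝ → ℝ) :=
  {f | AEMeasurable f halfLine ∧ hφ.lorentzNorm f < ∞}

/-- Two nonnegative functions on `(0, ∞)` are equimeasurable if they have the same distribution
function. -/
def Equimeasurable (f g : ℝ → ℝ≥0∞) : Prop :=
  ∀ s : ℝ≥0∞, halfLine {x | s < f x} = halfLine {x | s < g x}

/-- A rearrangement invariant Banach function space on `(0, ∞)`, given by its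
function norm on nonnegative measurable functions (in the sense of Luxemburg, and of
Bennett and Sharpley). -/
structure RISpace where
  /-- The function norm `ρ`. -/
  norm : (ℝ → ℝ≥0∞) → ℝ≥0∞
  norm_eq_zero_iff : ∀ f, AEMeasurable f halfLine → (norm f = 0 ↔ f =ᵐ[halfLine] 0)
  norm_smul : ∀ (a : ℝ≥0) f, AEMeasurable f halfLine → norm (fun t => a * f t) = a * norm f
  norm_add_le : ∀ f g, AEMeasurable f halfLine → AEMeasurable g halfLine →
    norm (fun t => f t + g t) ≤ norm f + norm g
  norm_mono : ∀ f g, AEMeasurable f halfLine → AEMeasurable g halfLine →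
    f ≤ᵐ[halfLine] g → norm f ≤ norm g
  /-- The Fatou property. -/
  norm_iSup : ∀ f : ℕ → ℝ → ℝ≥0∞, (∀ n, AEMeasurable (f n) halfLine) →
    (∀ᵐ t ∂halfLine, Monotone fun n => f n t) → norm (fun t => ⨆ n, f n t) = ⨆ n, norm (f n)
  norm_indicator_lt_top : ∀ E, MeasurableSet E → halfLine E < ∞ →
    norm (E.indicator fun _ => 1) < ∞
  lintegral_le : ∀ E, MeasurableSet E → halfLine E < ∞ →
    ∃ C : ℝ≥0, ∀ f, AEMeasurable f halfLine → ∫⁻ t in E, f t ∂halfLine ≤ C * norm f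
  /-- Rearrangement invariance. -/
  norm_eq_of_equimeasurable : ∀ f g, AEMeasurable f halfLine → AEMeasurable g halfLine →
    (∀ᵐ t ∂halfLine, f t < ∞) → (∀ᵐ t ∂halfLine, g t < ∞) → Equimeasurable f g → norm f = norm g

/-- The elements of the space: all measurable `f` with `‖f‖ = ρ(|f|) < ∞`. -/
def RISpace.carrier (Y : RISpace) : Set (ℝ → ℝ) :=
  {f | AEMeasurable f halfLine ∧ Y.norm (fun t => ‖f t‖ₑ) < ∞}

/-- The fundamental function `φ_Y(t) = ‖χ_{(0,t)}‖_Y`. -/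
def RISpace.fundamentalFunction (Y : RISpace) (t : ℝ) : ℝ :=
  (Y.norm ((Ioo 0 t).indicator fun _ => 1)).toReal

/-- The fundamental function is given by any set of measure `t`. -/
theorem RISpace.fundamentalFunction_spec (Y : RISpace) (t : ℝ) (A : Set ℝ)
    (hA : MeasurableSet A) (hAt : halfLine A = ENNReal.ofReal t) :
    Y.norm (A.indicator fun _ => 1) = ENNReal.ofReal (Y.fundamentalFunction t) := by
  have key : ∀ (B : Set ℝ) (s : ℝ≥0∞),
      halfLine {x | s < B.indicator (fun _ => (1 : ℝ≥0∞)) x} =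
        if s < 1 then halfLine B else 0 := by
    intro B s
    split_ifs with h
    · congr 1
      ext x
      by_cases hx : x ∈ B <;> simp [hx, h]
    · convert measure_empty (μ := halfLine)
      ext x
      by_cases hx : x ∈ B <;> simp [hx, not_lt.mp h]
  have hI : halfLine (Ioo 0 t) = ENNReal.ofReal t := by
    rw [Measure.restrict_apply measurableSet_Ioo,
      inter_eq_left.mpr (fun x hx => hx.1), Real.volume_Ioo, sub_zero]
  have hm : ∀ B : Set ℝ, MeasurableSet B →
      AEMeasurable (B.indicator fun _ => (1 : ℝ≥0∞)) halfLine := fun B hB =>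
    (measurable_const.indicator hB).aemeasurable
  have hf : ∀ B : Set ℝ, ∀ᵐ x ∂halfLine, B.indicator (fun _ => (1 : ℝ≥0∞)) x < ∞ := fun B =>
    Filter.Eventually.of_forall fun x => by by_cases hx : x ∈ B <;> simp [hx]
  have h := Y.norm_eq_of_equimeasurable _ _ (hm A hA) (hm _ measurableSet_Ioo) (hf A)
    (hf (Ioo 0 t)) (fun s => by rw [key, key, hAt, hI])
  rw [h, RISpace.fundamentalFunction, ENNReal.ofReal_toReal]
  exact (Y.norm_indicator_lt_top _ measurableSet_Ioo (hI ▸ ENNReal.ofReal_lt_top)).ne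

/-- The Hardy operator `Sf(t) = (1/t) ∫_0^t f(r) dr`. -/
def hardy (f : ℝ → ℝ) (t : ℝ) : ℝ := (1 / t) * ∫ r in (0)..t, f r

/-- The Hardy operator is bounded from `Λ_φ` to `Y`. -/
def HardyBounded {φ : ℝ → ℝ} (hφ : QuasiConcave φ) (Y : RISpace) : Prop :=
  ∃ C : ℝ≥0, ∀ f ∈ hφ.lorentzSpace, (∀ t, 0 < t → IntervalIntegrable f volume 0 t) ∧
    Y.norm (fun t => ‖hardy f t‖ₑ) ≤ C * hφ.lorentzNorm f

/-- `Y` is the optimal range space of the Hardy operator on `Λ_φ`: the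
minimal rearrangement invariant Banach function space `Y` such that `S : Λ_φ → Y` is bounded. -/
def IsOptimalRange {φ : ℝ → ℝ} (hφ : QuasiConcave φ) (Y : RISpace) : Prop :=
  HardyBounded hφ Y ∧ ∀ Z : RISpace, HardyBounded hφ Z → Y.carrier ⊆ Z.carrier

/-- The auxiliary function `φ̃(t) = inf_{r > 0} t φ(r) / (r log (1 + t / r))`. -/
def auxFunction (φ : ℝ → ℝ) (t : ℝ) : ℝ :=
  ⨅ r : Ioi (0 : ℝ), t * φ r / (r * Real.log (1 + t / r))

end

noncomputable section

/-! Upper bound. If `S : Λ_φ → Y` is bounded with constant `C`, test it on `χ_(0,r)`. Then `S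
χ_(0,r) (x) = min(x,r)/x` dominates the step function with values `1, 1/2, ..., 1/n` on `n = ⌈t/r⌉`
equal pieces of `(0,t)`. Its cyclic shifts are equimeasurable and add up to a constant of size at
least `log (n+1)` on `(0,t)`, so `φ_Y(t) log (n+1) ≤ n ‖S χ_(0,r)‖_Y ≤ 2 n C φ(r)`. Optimising in
`r` gives `φ_Y(t) ≤ 4 C φ̃(t)` (`HardyBounded.norm_indicator_le`).

Lower bound. The Marcinkiewicz norm `sup_t φ̃(t) t⁻¹ ∫_0^t f^*` is at least `φ̃(t)` on `χ_(0,t)`,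
and `S` maps `Λ_φ` boundedly into this space. Indeed `|Sf| ≤ f^{**}`, and `f^{**}(s)` is the
integral over the levels `u` of `min(1, D(u)/s)`, where `D` is the distribution function of `|f|`.
At one level with `m = D(u)`, `∫_0^t min(1, m/s) ds ≤ 2 m log(1 + t/m)`, and the definition of `φ̃`
with `r = m` turns this into a multiple of `φ(m)`. Integrating over levels returns `‖f‖_{Λ_φ}`.
Minimality puts the optimal range inside this space, and such an inclusion is automatically bounded.

Existence. The upper bound is linear in `C`, so the supremum of `C⁻¹ ‖·‖_Z` over all admissible
pairs `(Z, C)` is finite on sets of finite measure, and this supremum is the optimal norm. The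
logarithmic lower bound on `φ` makes `φ̃` positive, which makes the Marcinkiewicz functional a norm
and functions in `Λ_φ` locally integrable. -/

/-! ### Distribution functions and the functional `∫_0^t f^*`. -/

/-- The distribution function `u ↦ |{x > 0 : f x > u}|`. -/
def distrib (f : ℝ → ℝ≥0∞) (u : ℝ) : ℝ≥0∞ := halfLine {x | ENNReal.ofReal u < f x}

theorem distrib_antitone (f : ℝ → ℝ≥0∞) : Antitone (distrib f) := fun _ _ h =>
  measure_mono fun _ hx => (ENNReal.ofReal_le_ofReal h).trans_lt hx

theorem distrib_mono {f g : ℝ → ℝ≥0∞} (h : f ≤ᵐ[halfLine] g) (u : ℝ) :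
    distrib f u ≤ distrib g u :=
  measure_mono_ae (h.mono fun _ hx hu => lt_of_lt_of_le hu hx)

theorem volume_Ioi_inter_ofReal_lt (a : ℝ≥0∞) :
    volume (Ioi (0 : ℝ) ∩ {u | ENNReal.ofReal u < a}) = a := by
  induction a with
  | top => simp
  | coe a =>
    have : Ioi (0 : ℝ) ∩ {u | ENNReal.ofReal u < a} = Ioo 0 (a : ℝ) := by
      ext u
      simp only [mem_inter_iff, mem_Ioi, mem_ofPred_eq, mem_Ioo, and_congr_right_iff]
      intro hu
      rw [ENNReal.ofReal_lt_iff_lt_toReal hu.le ENNReal.coe_ne_top, ENNReal.coe_toReal]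
    rw [this, Real.volume_Ioo, sub_zero, ENNReal.ofReal_coe_nnreal]

/-- Layer cake formula for functions with values in `[0, ∞]`. -/
theorem lintegral_eq_lintegral_meas_ofReal_lt {α : Type*} [MeasurableSpace α] (μ : Measure α)
    [SFinite μ] {f : α → ℝ≥0∞} (hf : AEMeasurable f μ) :
    ∫⁻ x, f x ∂μ = ∫⁻ u in Ioi (0 : ℝ), μ {x | ENNReal.ofReal u < f x} := by
  wlog hm : Measurable f generalizing f
  · rw [lintegral_congr_ae hf.ae_eq_mk, this hf.measurable_mk.aemeasurable hf.measurable_mk]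
    refine lintegral_congr fun u => measure_congr ?_
    filter_upwards [hf.ae_eq_mk] with x hx
    change (ENNReal.ofReal u < _) = (ENNReal.ofReal u < _)
    rw [hx]
  have hS : MeasurableSet {p : α × ℝ | ENNReal.ofReal p.2 < f p.1} :=
    measurableSet_lt (by fun_prop) (by fun_prop)
  have h1 : ∀ x, f x = ∫⁻ u in Ioi (0 : ℝ),
      ({p : α × ℝ | ENNReal.ofReal p.2 < f p.1}.indicator 1 (x, u) : ℝ≥0∞) := fun x => by
    have : (fun u => ({p : α × ℝ | ENNReal.ofReal p.2 < f p.1}.indicator 1 (x, u) : ℝ≥0∞)) =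
        {u | ENNReal.ofReal u < f x}.indicator 1 := by
      ext u; simp [indicator]
    rw [this, lintegral_indicator_one (measurableSet_lt (by fun_prop) (by fun_prop)),
      Measure.restrict_apply (measurableSet_lt (by fun_prop) (by fun_prop)), inter_comm,
      volume_Ioi_inter_ofReal_lt]
  rw [lintegral_congr h1, lintegral_lintegral_swap
    (f := fun x u => ({p : α × ℝ | ENNReal.ofReal p.2 < f p.1}.indicator 1 (x, u) : ℝ≥0∞))
    (measurable_one.indicator hS).aemeasurable]
  refine lintegral_congr fun u => ?_
  have : (fun x => ({p : α × ℝ | ENNReal.ofReal p.2 < f p.1}.indicator 1 (x, u) : ℝ≥0∞)) =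
      {x | ENNReal.ofReal u < f x}.indicator 1 := by
    ext x; simp [indicator]
  rw [this, lintegral_indicator_one (measurableSet_lt (by fun_prop) (by fun_prop))]

/-- `∫_0^t f^*`, expressed by the distribution function of `f`. -/
def kFunctional (f : ℝ → ℝ≥0∞) (t : ℝ) : ℝ≥0∞ :=
  ∫⁻ u in Ioi (0 : ℝ), min (ENNReal.ofReal t) (distrib f u)

theorem kFunctional_mono {f g : ℝ → ℝ≥0∞} (h : f ≤ᵐ[halfLine] g) (t : ℝ) :
    kFunctional f t ≤ kFunctional g t :=
  lintegral_mono fun u => min_le_min_left _ (distrib_mono h u)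

/-- Hardy–Littlewood: a level set intersected with `E` has measure at most both `t` and `D(u)`. -/
theorem setLIntegral_le_kFunctional {f : ℝ → ℝ≥0∞} (hf : AEMeasurable f halfLine) {E : Set ℝ}
    {t : ℝ} (hE : halfLine E ≤ ENNReal.ofReal t) :
    ∫⁻ x in E, f x ∂halfLine ≤ kFunctional f t := by
  rw [lintegral_eq_lintegral_meas_ofReal_lt _ hf.restrict]
  refine lintegral_mono fun u => le_min ?_ (Measure.restrict_apply_le _ _)
  exact (measure_mono (subset_univ _)).trans (by simpa using hE)

theorem aemeasurable_sub_const {f : ℝ → ℝ≥0∞} (hf : AEMeasurable f halfLine) (c : ℝ≥0∞) :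
    AEMeasurable (fun x => f x - c) halfLine :=
  hf.sub aemeasurable_const

theorem lintegral_Ioi_distrib_sub {f : ℝ → ℝ≥0∞} (hf : AEMeasurable f halfLine) {l : ℝ}
    (hl : 0 ≤ l) :
    ∫⁻ x, (f x - ENNReal.ofReal l) ∂halfLine = ∫⁻ u in Ioi l, distrib f u := by
  rw [lintegral_eq_lintegral_meas_ofReal_lt _ (aemeasurable_sub_const hf _),
    ← lintegral_indicator measurableSet_Ioi, ← lintegral_indicator measurableSet_Ioi,
    ← lintegral_add_right_eq_self ((Ioi l).indicator _) l]
  refine lintegral_congr fun u => ?_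
  by_cases hu : 0 < u
  · rw [indicator_of_mem (mem_Ioi.2 hu), indicator_of_mem (mem_Ioi.2 (by linarith))]
    simp only [distrib, ENNReal.ofReal_add hu.le hl, lt_tsub_iff_right]
  · rw [indicator_of_notMem (by simpa using hu), indicator_of_notMem (by simpa using hu)]

theorem lintegral_Ioc_add_Ioi (F : ℝ → ℝ≥0∞) {l : ℝ} (hl : 0 ≤ l) :
    ∫⁻ u in Ioi (0 : ℝ), F u = (∫⁻ u in Ioc 0 l, F u) + ∫⁻ u in Ioi l, F u := by
  rw [← Ioc_union_Ioi_eq_Ioi hl, lintegral_union measurableSet_Ioi]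
  exact disjoint_left.2 fun x hx hx' => (not_lt.2 hx.2) hx'

/-- With `exists_kFunctional_eq` this gives `∫_0^t f^* = min_l (t l + ∫ (f - l)_+)`, the
K-functional of `(L¹, L^∞)`. Subadditivity and homogeneity in `f` follow from this form. -/
theorem kFunctional_le {f : ℝ → ℝ≥0∞} (hf : AEMeasurable f halfLine) (t : ℝ) {l : ℝ}
    (hl : 0 ≤ l) :
    kFunctional f t ≤
      ENNReal.ofReal t * ENNReal.ofReal l + ∫⁻ x, (f x - ENNReal.ofReal l) ∂halfLine := by
  rw [kFunctional, lintegral_Ioc_add_Ioi _ hl, lintegral_Ioi_distrib_sub hf hl]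
  refine add_le_add ?_ (lintegral_mono fun u => min_le_right _ _)
  calc ∫⁻ u in Ioc 0 l, min (ENNReal.ofReal t) (distrib f u)
      ≤ ∫⁻ u in Ioc 0 l, ENNReal.ofReal t := lintegral_mono fun u => min_le_left _ _
    _ = _ := by simp

theorem exists_kFunctional_eq {f : ℝ → ℝ≥0∞} (hf : AEMeasurable f halfLine) {t : ℝ}
    (ht : 0 < t) (hK : kFunctional f t ≠ ∞) :
    ∃ l : ℝ, 0 ≤ l ∧ kFunctional f t =
      ENNReal.ofReal t * ENNReal.ofReal l + ∫⁻ x, (f x - ENNReal.ofReal l) ∂halfLine := by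
  -- The minimising level is `inf A = f^*(t)`: below it the minimum is `t`, above it the minimum is
  -- `D(u)`. If `A` is empty, the integrand is constantly `t` and the integral diverges.
  set A : Set ℝ := {u | 0 ≤ u ∧ distrib f u ≤ ENNReal.ofReal t} with hA
  have hbdd : BddBelow A := ⟨0, fun u hu => hu.1⟩
  have hne : A.Nonempty := by
    by_contra hne
    rw [not_nonempty_iff_eq_empty] at hne
    refine hK ?_
    have : ∀ u ∈ Ioi (0 : ℝ), min (ENNReal.ofReal t) (distrib f u) = ENNReal.ofReal t := by
      intro u hu
      refine min_eq_left (le_of_not_ge fun h => ?_)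
      have : u ∈ A := ⟨le_of_lt hu, h⟩
      simp [hne] at this
    rw [kFunctional, setLIntegral_congr_fun measurableSet_Ioi this]
    simp [ENNReal.mul_top, ht]
  have hl : 0 ≤ sInf A := le_csInf hne fun u hu => hu.1
  refine ⟨sInf A, hl, ?_⟩
  rw [kFunctional, lintegral_Ioc_add_Ioi _ hl, lintegral_Ioi_distrib_sub hf hl]
  congr 1
  · rw [← restrict_Ioo_eq_restrict_Ioc]
    have : ∀ u ∈ Ioo 0 (sInf A), min (ENNReal.ofReal t) (distrib f u) = ENNReal.ofReal t := by
      intro u hu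
      refine min_eq_left (le_of_not_ge fun h => ?_)
      exact not_lt.2 (csInf_le hbdd ⟨hu.1.le, h⟩) hu.2
    rw [setLIntegral_congr_fun measurableSet_Ioo this]
    simp
  · refine setLIntegral_congr_fun measurableSet_Ioi fun u hu => min_eq_right ?_
    obtain ⟨v, hv, hvu⟩ := exists_lt_of_csInf_lt hne hu
    exact (distrib_antitone f hvu.le).trans hv.2

theorem kFunctional_add_le {f g : ℝ → ℝ≥0∞} (hf : AEMeasurable f halfLine)
    (hg : AEMeasurable g halfLine) {t : ℝ} (ht : 0 < t) :
    kFunctional (fun x => f x + g x) t ≤ kFunctional f t + kFunctional g t := by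
  by_cases h1 : kFunctional f t = ∞
  · simp [h1]
  by_cases h2 : kFunctional g t = ∞
  · simp [h2]
  obtain ⟨l, hl, hfl⟩ := exists_kFunctional_eq hf ht h1
  obtain ⟨m, hm, hgm⟩ := exists_kFunctional_eq hg ht h2
  rw [hfl, hgm]
  refine (kFunctional_le (hf.add hg) t (add_nonneg hl hm)).trans ?_
  rw [ENNReal.ofReal_add hl hm, mul_add, add_add_add_comm,
    ← lintegral_add_left' (aemeasurable_sub_const hf _)]
  gcongr with x
  exact add_tsub_add_le_tsub_add_tsub

theorem kFunctional_smul_le {f : ℝ → ℝ≥0∞} (hf : AEMeasurable f halfLine) {t : ℝ} (ht : 0 < t)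
    (a : ℝ≥0) : kFunctional (fun x => a * f x) t ≤ a * kFunctional f t := by
  by_cases h1 : kFunctional f t = ∞
  · by_cases ha : a = 0
    · simp [ha, kFunctional, distrib]
    · simp [h1, ha]
  obtain ⟨l, hl, hfl⟩ := exists_kFunctional_eq hf ht h1
  refine (kFunctional_le (hf.const_mul _) t (mul_nonneg a.coe_nonneg hl)).trans ?_
  have h2 : ENNReal.ofReal (a * l) = a * ENNReal.ofReal l := by
    rw [ENNReal.ofReal_mul a.coe_nonneg, ENNReal.ofReal_coe_nnreal]
  rw [hfl, h2, mul_add, mul_left_comm, ← lintegral_const_mul'' _ (aemeasurable_sub_const hf _)]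
  simp [ENNReal.mul_sub]

theorem kFunctional_smul {f : ℝ → ℝ≥0∞} (hf : AEMeasurable f halfLine) {t : ℝ} (ht : 0 < t)
    (a : ℝ≥0) : kFunctional (fun x => a * f x) t = a * kFunctional f t := by
  refine le_antisymm (kFunctional_smul_le hf ht a) ?_
  by_cases ha : a = 0
  · simp [ha]
  have ha' : (a : ℝ≥0∞) ≠ 0 := by simpa using ha
  have h := kFunctional_smul_le (hf.const_mul (a : ℝ≥0∞)) ht a⁻¹
  have h2 : (fun x => ((a⁻¹ : ℝ≥0) : ℝ≥0∞) * (a * f x)) = f := by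
    ext x
    rw [← mul_assoc, ← ENNReal.coe_mul, inv_mul_cancel₀ ha, ENNReal.coe_one, one_mul]
  rw [h2] at h
  calc (a : ℝ≥0∞) * kFunctional f t ≤ a * (((a⁻¹ : ℝ≥0) : ℝ≥0∞) * _) := by gcongr
    _ = _ := by rw [← mul_assoc, ← ENNReal.coe_mul, mul_inv_cancel₀ ha, ENNReal.coe_one, one_mul]

theorem distrib_iSup {f : ℕ → ℝ → ℝ≥0∞} (hmono : ∀ᵐ x ∂halfLine, Monotone fun n => f n x)
    (u : ℝ) : distrib (fun x => ⨆ n, f n x) u = ⨆ n, distrib (f n) u := by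
  -- Restricting to the conull set where the sequence is monotone makes the level sets increase
  -- everywhere, as continuity from below requires.
  set S : Set ℝ := {x | Monotone fun n => f n x}
  have key : ∀ g : ℝ → ℝ≥0∞, distrib g u = halfLine ({x | ENNReal.ofReal u < g x} ∩ S) :=
    fun g => measure_congr <| by
      filter_upwards [hmono] with x hx
      change (ENNReal.ofReal u < g x) = (ENNReal.ofReal u < g x ∧ Monotone fun n => f n x)
      exact propext ⟨fun h => ⟨h, hx⟩, fun h => h.1⟩
  simp_rw [key]
  rw [← Monotone.measure_iUnion]
  · congr 1
    ext x
    simp [lt_iSup_iff]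
  · intro m n hmn x hx
    exact ⟨lt_of_lt_of_le hx.1 (hx.2 hmn), hx.2⟩

theorem kFunctional_iSup {f : ℕ → ℝ → ℝ≥0∞} (hmono : ∀ᵐ x ∂halfLine, Monotone fun n => f n x)
    (t : ℝ) : kFunctional (fun x => ⨆ n, f n x) t = ⨆ n, kFunctional (f n) t := by
  unfold kFunctional
  rw [← lintegral_iSup (fun n => measurable_const.min (distrib_antitone _).measurable)]
  · refine lintegral_congr fun u => ?_
    rw [distrib_iSup hmono, inf_iSup_eq]
  · intro m n hmn u
    exact min_le_min_left _ (distrib_mono (hmono.mono fun x hx => hx hmn) u)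

theorem kFunctional_indicator (E : Set ℝ) (t : ℝ) :
    kFunctional (E.indicator fun _ => 1) t = min (ENNReal.ofReal t) (halfLine E) := by
  have h1 : ∀ u ∈ Ioi (0 : ℝ), min (ENNReal.ofReal t) (distrib (E.indicator fun _ => 1) u) =
      (Ioo (0 : ℝ) 1).indicator (fun _ => min (ENNReal.ofReal t) (halfLine E)) u := by
    intro u hu
    have hu' : (0 : ℝ) < u := hu
    by_cases hu1 : u < 1
    · rw [indicator_of_mem (show u ∈ Ioo (0 : ℝ) 1 from ⟨hu, hu1⟩), distrib]
      congr 2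
      ext x
      by_cases hx : x ∈ E <;> simp [hx, hu1]
    · rw [indicator_of_notMem (fun h => hu1 h.2), distrib]
      have : {x | ENNReal.ofReal u < E.indicator (fun _ => (1 : ℝ≥0∞)) x} = ∅ := by
        ext x
        by_cases hx : x ∈ E <;> simp [hx, not_lt.1 hu1]
      simp [this]
  rw [kFunctional, setLIntegral_congr_fun measurableSet_Ioi h1,
    lintegral_indicator measurableSet_Ioo, Measure.restrict_restrict measurableSet_Ioo,
    inter_eq_left.2 fun x hx => hx.1]
  simp

theorem ae_eq_zero_of_kFunctional_eq_zero {f : ℝ → ℝ≥0∞} (hf : AEMeasurable f halfLine) {t : ℝ}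
    (ht : 0 < t) (h : kFunctional f t = 0) : f =ᵐ[halfLine] 0 := by
  rw [← lintegral_eq_zero_iff' hf, lintegral_eq_lintegral_meas_ofReal_lt _ hf]
  rw [kFunctional, lintegral_eq_zero_iff (measurable_const.min (distrib_antitone _).measurable)]
    at h
  rw [← lintegral_zero (μ := volume.restrict (Ioi (0 : ℝ)))]
  refine lintegral_congr_ae (h.mono fun u hu => ?_)
  simp only [Pi.zero_apply] at hu
  rcases min_eq_iff.1 hu with h | h
  · simp [not_le.2 ht] at h
  · exact h.1

/-! ### The auxiliary function `φ̃`. -/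

theorem log_one_add_div_pos {t r : ℝ} (ht : 0 < t) (hr : 0 < r) : 0 < Real.log (1 + t / r) :=
  Real.log_pos (by have := div_pos ht hr; linarith)

theorem auxFunction_term_pos {φ : ℝ → ℝ} (hφ : QuasiConcave φ) {t r : ℝ} (ht : 0 < t)
    (hr : 0 < r) : 0 < t * φ r / (r * Real.log (1 + t / r)) :=
  div_pos (mul_pos ht (hφ.pos r hr)) (mul_pos hr (log_one_add_div_pos ht hr))

theorem auxFunction_le {φ : ℝ → ℝ} (hφ : QuasiConcave φ) {t r : ℝ} (ht : 0 < t) (hr : 0 < r) :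
    auxFunction φ t ≤ t * φ r / (r * Real.log (1 + t / r)) :=
  ciInf_le (f := fun r : Ioi (0 : ℝ) => t * φ r / (r * Real.log (1 + t / r)))
    ⟨0, by rintro _ ⟨r, rfl⟩; exact (auxFunction_term_pos hφ ht r.2).le⟩ ⟨r, hr⟩

theorem le_auxFunction {φ : ℝ → ℝ} {t c : ℝ}
    (h : ∀ r, 0 < r → c ≤ t * φ r / (r * Real.log (1 + t / r))) : c ≤ auxFunction φ t :=
  le_ciInf (f := fun r : Ioi (0 : ℝ) => t * φ r / (r * Real.log (1 + t / r))) fun r => h r r.2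

/-- Bernoulli's inequality with exponent `max 1 t`. It transfers the growth hypothesis on `φ`,
stated with `log (1 + 1/r)`, to every `t`. -/
theorem log_one_add_div_le {t r : ℝ} (ht : 0 < t) (hr : 0 < r) :
    Real.log (1 + t / r) ≤ max 1 t * Real.log (1 + 1 / r) := by
  have hr' : 0 < 1 / r := by positivity
  rw [← Real.log_rpow (by positivity)]
  refine Real.log_le_log (by positivity) ?_
  calc 1 + t / r ≤ 1 + max 1 t * (1 / r) := by
        rw [div_eq_mul_one_div]; gcongr; exact le_max_right _ _
    _ ≤ _ := one_add_mul_self_le_rpow_one_add (by linarith) (le_max_left _ _)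

theorem auxFunction_pos {φ : ℝ → ℝ}
    (h : ∃ C : ℝ, 0 < C ∧ ∀ t : ℝ, 0 < t → C * t * Real.log (1 + 1 / t) ≤ φ t) {t : ℝ}
    (ht : 0 < t) : 0 < auxFunction φ t := by
  obtain ⟨C, hC, h⟩ := h
  have hm : 0 < max 1 t := lt_max_of_lt_left one_pos
  refine lt_of_lt_of_le (show 0 < C * t / max 1 t by positivity) (le_auxFunction fun r hr => ?_)
  have hl := log_one_add_div_pos ht hr
  rw [div_le_div_iff₀ hm (by positivity)]
  calc C * t * (r * Real.log (1 + t / r))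
      ≤ C * t * (r * (max 1 t * Real.log (1 + 1 / r))) := by
        gcongr; exact log_one_add_div_le ht hr
    _ = t * (C * r * Real.log (1 + 1 / r)) * max 1 t := by ring
    _ ≤ t * φ r * max 1 t := by gcongr; exact h r hr

/-- Take `r = min t m` in the infimum; then `log (1 + t/r) ≥ log 2 ≥ 1/2`. This is the finiteness of
the Marcinkiewicz norm on sets of measure `m`. -/
theorem auxFunction_div_mul_min_le {φ : ℝ → ℝ} (hφ : QuasiConcave φ) {t m : ℝ} (ht : 0 < t)
    (hm : 0 < m) : auxFunction φ t / t * min t m ≤ 2 * φ m := by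
  have hl2 : (1 / 2 : ℝ) ≤ Real.log 2 := by linarith [Real.log_two_gt_d9]
  have hφm := hφ.pos m hm
  have hlog : ∀ r, 0 < r → r ≤ t → 1 / 2 ≤ Real.log (1 + t / r) := fun r hr hrt =>
    hl2.trans (Real.log_le_log two_pos (by
      have : 1 ≤ t / r := (one_le_div hr).2 hrt
      linarith))
  have key : ∀ r, 0 < r → r ≤ t → auxFunction φ t / t * r ≤ 2 * φ r := by
    intro r hr hrt
    have h1 := hlog r hr hrt
    have h2 := log_one_add_div_pos ht hr
    have h3 := hφ.pos r hr
    have h4 := auxFunction_le hφ ht hr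
    rw [le_div_iff₀ (by positivity)] at h4
    rw [div_mul_eq_mul_div, div_le_iff₀ ht]
    by_cases h5 : 0 ≤ auxFunction φ t
    · have : auxFunction φ t * (r * (1 / 2)) ≤ auxFunction φ t * (r * Real.log (1 + t / r)) := by
        gcongr
      linarith
    · have : auxFunction φ t * r ≤ 0 := mul_nonpos_of_nonpos_of_nonneg (not_le.1 h5).le hr.le
      have : 0 ≤ 2 * φ r * t := by positivity
      linarith
  rcases le_total t m with h | h
  · rw [min_eq_left h]
    exact (key t ht le_rfl).trans (by gcongr; exact hφ.mono ht hm h)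
  · rw [min_eq_right h]
    exact key m hm h

/-! ### The Marcinkiewicz space. -/

/-- The Marcinkiewicz space with norm `sup_{t > 0} w(t) ∫_0^t f^*`. -/
def marcinkiewicz (w : ℝ → ℝ≥0) (hpos : ∀ t, 0 < t → 0 < w t)
    (hw : ∀ m, 0 < m → ∃ C : ℝ≥0, ∀ t : ℝ, 0 < t → w t * min t m ≤ C) : RISpace where
  norm f := ⨆ t : Ioi (0 : ℝ), w t * kFunctional f t
  norm_eq_zero_iff f hf := by
    constructor
    · intro h
      have h1 := (ENNReal.iSup_eq_zero.1 h) ⟨1, mem_Ioi.2 one_pos⟩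
      have h2 : (w 1 : ℝ≥0∞) ≠ 0 := by simpa using (hpos 1 one_pos).ne'
      exact ae_eq_zero_of_kFunctional_eq_zero hf one_pos ((mul_eq_zero.1 h1).resolve_left h2)
    · intro h
      rw [ENNReal.iSup_eq_zero]
      intro t
      have : kFunctional f t ≤ kFunctional (fun _ => 0) t := kFunctional_mono h.le t
      have h0 : kFunctional (fun _ => 0) (t : ℝ) = 0 := by simp [kFunctional, distrib]
      rw [le_antisymm (this.trans h0.le) bot_le]
      simp
  norm_smul a f hf := by
    rw [ENNReal.mul_iSup]
    refine iSup_congr fun t => ?_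
    rw [kFunctional_smul hf t.2, mul_left_comm]
  norm_add_le f g hf hg := by
    refine iSup_le fun t => ?_
    calc (w t : ℝ≥0∞) * kFunctional (fun x => f x + g x) t
        ≤ w t * (kFunctional f t + kFunctional g t) := by
          gcongr; exact kFunctional_add_le hf hg t.2
      _ = w t * kFunctional f t + w t * kFunctional g t := mul_add _ _ _
      _ ≤ _ := add_le_add
          (le_iSup (fun t : Ioi (0 : ℝ) => (w t : ℝ≥0∞) * kFunctional f t) t)
          (le_iSup (fun t : Ioi (0 : ℝ) => (w t : ℝ≥0∞) * kFunctional g t) t)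
  norm_mono f g _ _ h := by
    gcongr with t
    exact kFunctional_mono h t
  norm_iSup f _ hmono := by
    rw [iSup_comm]
    refine iSup_congr fun t => ?_
    rw [kFunctional_iSup hmono, ENNReal.mul_iSup]
  norm_indicator_lt_top E _ hE := by
    -- The maximum with `1` keeps the measure parameter positive when `E` is null.
    obtain ⟨C, hC⟩ := hw (max 1 (halfLine E).toReal) (lt_max_of_lt_left one_pos)
    refine lt_of_le_of_lt (iSup_le fun t => ?_) (ENNReal.coe_lt_top (r := C))
    rw [kFunctional_indicator]
    calc (w t : ℝ≥0∞) * min (ENNReal.ofReal t) (halfLine E)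
        ≤ ENNReal.ofReal (w t) *
            min (ENNReal.ofReal t) (ENNReal.ofReal (max 1 (halfLine E).toReal)) := by
          rw [ENNReal.ofReal_coe_nnreal]
          gcongr
          rw [← ENNReal.ofReal_toReal hE.ne]
          refine ENNReal.ofReal_le_ofReal ?_
          rw [ENNReal.toReal_ofReal ENNReal.toReal_nonneg]
          exact le_max_right _ _
      _ = ENNReal.ofReal (w t * min (t : ℝ) (max 1 (halfLine E).toReal)) := by
          rw [ENNReal.ofReal_mul (w t).coe_nonneg, ENNReal.ofReal_min]
      _ ≤ ENNReal.ofReal C := ENNReal.ofReal_le_ofReal (hC t t.2)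
      _ = C := ENNReal.ofReal_coe_nnreal
  lintegral_le E _ hE := by
    set m := max 1 (halfLine E).toReal
    have hm : 0 < m := lt_max_of_lt_left one_pos
    have hEm : halfLine E ≤ ENNReal.ofReal m := by
      rw [← ENNReal.ofReal_toReal hE.ne]
      exact ENNReal.ofReal_le_ofReal (le_max_right _ _)
    refine ⟨(w m)⁻¹, fun f hf => (setLIntegral_le_kFunctional hf hEm).trans ?_⟩
    calc kFunctional f m = ((w m)⁻¹ : ℝ≥0) * (w m * kFunctional f m) := by
          rw [← mul_assoc, ← ENNReal.coe_mul, inv_mul_cancel₀ (hpos m hm).ne', ENNReal.coe_one,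
            one_mul]
      _ ≤ _ := by
          gcongr
          exact le_iSup (fun t : Ioi (0 : ℝ) => (w t : ℝ≥0∞) * kFunctional f t) ⟨m, hm⟩
  norm_eq_of_equimeasurable f g _ _ _ _ h := by
    have : distrib f = distrib g := funext fun u => h _
    simp only [kFunctional, this]

/-- The Marcinkiewicz space with norm `sup_{t > 0} φ̃(t) t⁻¹ ∫_0^t f^*`. -/
def QuasiConcave.auxMarcinkiewicz {φ : ℝ → ℝ} (hφ : QuasiConcave φ)
    (h : ∃ C : ℝ, 0 < C ∧ ∀ t : ℝ, 0 < t → C * t * Real.log (1 + 1 / t) ≤ φ t) : RISpace :=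
  marcinkiewicz (fun t => (auxFunction φ t / t).toNNReal)
    (fun t ht => Real.toNNReal_pos.2 (div_pos (auxFunction_pos h ht) ht))
    (fun m hm => ⟨(2 * φ m).toNNReal, fun t ht => by
      rw [Real.coe_toNNReal _ (div_pos (auxFunction_pos h ht) ht).le,
        Real.coe_toNNReal _ (mul_pos two_pos (hφ.pos m hm)).le]
      exact auxFunction_div_mul_min_le hφ ht hm⟩)

theorem QuasiConcave.auxMarcinkiewicz_norm {φ : ℝ → ℝ} (hφ : QuasiConcave φ)
    (h : ∃ C : ℝ, 0 < C ∧ ∀ t : ℝ, 0 < t → C * t * Real.log (1 + 1 / t) ≤ φ t)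
    (f : ℝ → ℝ≥0∞) : (hφ.auxMarcinkiewicz h).norm f =
      ⨆ t : Ioi (0 : ℝ), ENNReal.ofReal (auxFunction φ t / t) * kFunctional f t := rfl

theorem halfLine_Ioo_zero (t : ℝ) : halfLine (Ioo 0 t) = ENNReal.ofReal t := by
  rw [Measure.restrict_apply measurableSet_Ioo, inter_eq_left.mpr (fun x hx => hx.1),
    Real.volume_Ioo, sub_zero]

theorem QuasiConcave.auxFunction_le_auxMarcinkiewicz_norm {φ : ℝ → ℝ} (hφ : QuasiConcave φ)
    (h : ∃ C : ℝ, 0 < C ∧ ∀ t : ℝ, 0 < t → C * t * Real.log (1 + 1 / t) ≤ φ t) {t : ℝ}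
    (ht : 0 < t) : ENNReal.ofReal (auxFunction φ t) ≤
      (hφ.auxMarcinkiewicz h).norm ((Ioo 0 t).indicator fun _ => 1) := by
  rw [auxMarcinkiewicz_norm]
  refine le_iSup_of_le ⟨t, ht⟩ ?_
  rw [kFunctional_indicator, halfLine_Ioo_zero, min_self,
    ← ENNReal.ofReal_mul (div_pos (auxFunction_pos h ht) ht).le, div_mul_cancel₀ _ ht.ne']

/-! ### The measure `dφ` and the Lorentz norm. -/

theorem QuasiConcave.le_two_mul_half {φ : ℝ → ℝ} (hφ : QuasiConcave φ) {r : ℝ} (hr : 0 < r) :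
    φ r ≤ 2 * φ (r / 2) := by
  have h := hφ.anti (a := r / 2) (b := r) (half_pos hr) hr (by linarith)
  simp only at h
  rw [div_le_div_iff₀ hr (half_pos hr)] at h
  nlinarith

/-- The extension vanishes on the left of `0`, so the mass `φ(0+)` at `0` is counted in `[0, r]`. -/
theorem QuasiConcave.leftLim_stieltjesFunction_zero {φ : ℝ → ℝ} (hφ : QuasiConcave φ) :
    Function.leftLim hφ.monotone_extendZero.stieltjesFunction 0 = 0 := by
  have hm := hφ.monotone_extendZero
  have h0 : ∀ x, x ≤ 0 → extendZero φ x = 0 := fun x hx => if_pos hx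
  have hz : ∀ x < 0, hm.stieltjesFunction x = 0 := fun x hx => by
    rw [hm.stieltjesFunction_eq]
    refine le_antisymm ?_ ?_
    · exact (hm.rightLim_le hx).trans (h0 0 le_rfl).le
    · exact (h0 x hx.le).ge.trans (hm.le_rightLim le_rfl)
  refine le_antisymm ?_ ?_
  · exact le_of_tendsto (hm.stieltjesFunction.mono.tendsto_leftLim 0)
      (Filter.eventually_of_mem self_mem_nhdsWithin fun x hx => (hz x hx).le)
  · exact (hz (-1) (by norm_num)).ge.trans
      (hm.stieltjesFunction.mono.le_leftLim (by norm_num))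

theorem QuasiConcave.stieltjesMeasure_Icc {φ : ℝ → ℝ} (hφ : QuasiConcave φ) (r : ℝ) :
    hφ.stieltjesMeasure (Icc 0 r) = ENNReal.ofReal (Function.rightLim (extendZero φ) r) := by
  rw [stieltjesMeasure, StieltjesFunction.measure_Icc, hφ.leftLim_stieltjesFunction_zero,
    hφ.monotone_extendZero.stieltjesFunction_eq, sub_zero]

theorem QuasiConcave.le_stieltjesMeasure_Icc {φ : ℝ → ℝ} (hφ : QuasiConcave φ) {r : ℝ}
    (hr : 0 < r) : ENNReal.ofReal (φ r) ≤ hφ.stieltjesMeasure (Icc 0 r) := by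
  rw [hφ.stieltjesMeasure_Icc]
  refine ENNReal.ofReal_le_ofReal ?_
  have : extendZero φ r = φ r := if_neg (not_le.2 hr)
  rw [← this]
  exact hφ.monotone_extendZero.le_rightLim le_rfl

/-- Doubling replaces continuity: `φ(r+) ≤ φ(2r) ≤ 2 φ(r)`. -/
theorem QuasiConcave.stieltjesMeasure_Icc_le {φ : ℝ → ℝ} (hφ : QuasiConcave φ) {r : ℝ}
    (hr : 0 < r) : hφ.stieltjesMeasure (Icc 0 r) ≤ ENNReal.ofReal (2 * φ r) := by
  rw [hφ.stieltjesMeasure_Icc]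
  refine ENNReal.ofReal_le_ofReal ?_
  have h2 : extendZero φ (2 * r) = φ (2 * r) := if_neg (by linarith)
  have h3 := hφ.le_two_mul_half (r := 2 * r) (by linarith)
  rw [mul_div_cancel_left₀ r two_ne_zero] at h3
  exact (hφ.monotone_extendZero.rightLim_le (by linarith : r < 2 * r)).trans (h2.trans_le h3)

theorem QuasiConcave.ofReal_le_two_mul_stieltjesMeasure {φ : ℝ → ℝ} (hφ : QuasiConcave φ)
    {r : ℝ} (hr : 0 < r) {m : ℝ≥0∞} (hm : ENNReal.ofReal r ≤ m) :
    ENNReal.ofReal (φ r) ≤ 2 * hφ.stieltjesMeasure {t | 0 ≤ t ∧ ENNReal.ofReal t < m} := by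
  calc ENNReal.ofReal (φ r) ≤ ENNReal.ofReal (2 * φ (r / 2)) :=
        ENNReal.ofReal_le_ofReal (hφ.le_two_mul_half hr)
    _ = 2 * ENNReal.ofReal (φ (r / 2)) := by
        rw [ENNReal.ofReal_mul two_pos.le, ENNReal.ofReal_ofNat]
    _ ≤ 2 * hφ.stieltjesMeasure (Icc 0 (r / 2)) := by
        gcongr; exact hφ.le_stieltjesMeasure_Icc (half_pos hr)
    _ ≤ _ := by
        gcongr
        intro t ht
        refine ⟨ht.1, lt_of_lt_of_le ?_ hm⟩
        rw [ENNReal.ofReal_lt_ofReal_iff hr]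
        linarith [ht.2]

theorem decRearr_antitone (f : ℝ → ℝ) : Antitone (decRearr f) := fun _ _ h =>
  sInf_le_sInf fun _ hs => le_trans hs (ENNReal.ofReal_le_ofReal h)

/-- Right continuity of the distribution function: `f^*(t) ≤ u` gives `D(v) ≤ t` for all `v > u`,
hence `D(u) ≤ t`. -/
theorem ofReal_lt_decRearr {f : ℝ → ℝ} {t u : ℝ}
    (h : ENNReal.ofReal t < distrib (fun x => ‖f x‖ₑ) u) : ENNReal.ofReal u < decRearr f t := by
  by_contra! hc
  refine not_le.2 h ?_
  obtain ⟨v, hv, hvm, hvt⟩ := exists_seq_strictAnti_tendsto' (ENNReal.ofReal_lt_top (r := u))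
  have hset : {x | ENNReal.ofReal u < ‖f x‖ₑ} = ⋃ n, {x | v n < ‖f x‖ₑ} := by
    ext x
    simp only [mem_ofPred_eq, mem_iUnion]
    exact ⟨fun hx => (hvt.eventually_lt_const hx).exists, fun ⟨n, hn⟩ => (hvm n).1.trans hn⟩
  rw [distrib, hset, Monotone.measure_iUnion]
  · refine iSup_le fun n => ?_
    obtain ⟨s, hs, hsn⟩ := sInf_lt_iff.1 (lt_of_le_of_lt hc (hvm n).1)
    exact (measure_mono fun x hx => hsn.trans hx).trans hs
  · exact fun m n hmn x hx => lt_of_le_of_lt (hv.antitone hmn) hx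

/-- Layer cake for `f^*` with respect to `dφ`, as `t < D(u)` forces `f^*(t) > u`. -/
theorem QuasiConcave.lintegral_stieltjesMeasure_le_lorentzNorm {φ : ℝ → ℝ}
    (hφ : QuasiConcave φ) (f : ℝ → ℝ) :
    ∫⁻ u in Ioi (0 : ℝ), hφ.stieltjesMeasure
        {t | 0 ≤ t ∧ ENNReal.ofReal t < distrib (fun x => ‖f x‖ₑ) u} ≤ hφ.lorentzNorm f := by
  have : SFinite hφ.stieltjesMeasure := by unfold stieltjesMeasure; infer_instance
  rw [lorentzNorm, lintegral_eq_lintegral_meas_ofReal_lt _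
    (decRearr_antitone f).measurable.aemeasurable]
  refine lintegral_mono fun u => le_trans (measure_mono ?_) (Measure.le_restrict_apply _ _)
  exact fun t ht => ⟨ofReal_lt_decRearr ht.2, ht.1⟩

/-! ### Boundedness of the Hardy operator into the Marcinkiewicz space. -/

theorem integral_two_mul_div_add {m t : ℝ} (hm : 0 < m) (ht : 0 < t) :
    ∫ s in (0 : ℝ)..t, 2 * m / (m + s) = 2 * m * Real.log (1 + t / m) := by
  have hpos : ∀ s ∈ uIcc 0 t, 0 < m + s := fun s hs => by
    rw [uIcc_of_le ht.le] at hs; linarith [hs.1]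
  rw [intervalIntegral.integral_eq_sub_of_hasDerivAt (f := fun s => 2 * m * Real.log (m + s))]
  · rw [add_zero, ← mul_sub, ← Real.log_div (by positivity) hm.ne', add_div, div_self hm.ne']
  · intro s hs
    have := (((hasDerivAt_id' s).const_add m).log (hpos s hs).ne').const_mul (2 * m)
    rwa [mul_one_div] at this
  · refine ContinuousOn.intervalIntegrable ?_
    exact continuousOn_const.div (by fun_prop) fun s hs => (hpos s hs).ne'

/-- The majorant `2m/(m+s)` of `min(1, m/s)` has primitive `2m log (m+s)`, which produces exactly
the logarithm in `φ̃`. -/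
theorem lintegral_min_one_div_le {m t : ℝ} (hm : 0 < m) (ht : 0 < t) :
    ∫⁻ s in Ioo 0 t, min 1 (ENNReal.ofReal m / ENNReal.ofReal s) ≤
      ENNReal.ofReal (2 * m * Real.log (1 + t / m)) := by
  have hcont : ContinuousOn (fun s => 2 * m / (m + s)) (uIcc 0 t) := by
    refine continuousOn_const.div (by fun_prop) fun s hs => ?_
    rw [uIcc_of_le ht.le] at hs
    linarith [hs.1]
  rw [← integral_two_mul_div_add hm ht, intervalIntegral.integral_of_le ht.le,
    ofReal_integral_eq_lintegral_ofReal, ← restrict_Ioo_eq_restrict_Ioc]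
  · refine setLIntegral_mono' measurableSet_Ioo fun s hs => ?_
    have hs0 := hs.1
    rcases le_total s m with h | h
    · refine (min_le_left _ _).trans ?_
      rw [← ENNReal.ofReal_one]
      refine ENNReal.ofReal_le_ofReal ?_
      rw [le_div_iff₀ (by linarith)]
      linarith
    · refine (min_le_right _ _).trans ?_
      rw [← ENNReal.ofReal_div_of_pos hs0]
      refine ENNReal.ofReal_le_ofReal ?_
      rw [div_le_div_iff₀ hs0 (by linarith)]
      nlinarith
  · exact (hcont.intervalIntegrable).1
  · refine (ae_restrict_iff' measurableSet_Ioc).2 (Filter.Eventually.of_forall fun s hs => ?_)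
    have := hs.1
    simp only [Pi.zero_apply]
    positivity

/-- The boundedness of `S` at a single level. For finite `m > 0`, taking `r = m` in `φ̃` cancels the
logarithm; for `m = ∞` the integral is at most `t` and `r = t` serves. In the constant `4`, one
factor `2` comes from comparing `φ(r)` with the `dφ`-mass of `[0, r/2]`. -/
theorem QuasiConcave.auxFunction_mul_lintegral_min_le {φ : ℝ → ℝ} (hφ : QuasiConcave φ)
    (h : ∃ C : ℝ, 0 < C ∧ ∀ t : ℝ, 0 < t → C * t * Real.log (1 + 1 / t) ≤ φ t) {t : ℝ}
    (ht : 0 < t) (m : ℝ≥0∞) :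
    ENNReal.ofReal (auxFunction φ t / t) * ∫⁻ s in Ioo 0 t, min 1 (m / ENNReal.ofReal s) ≤
      4 * hφ.stieltjesMeasure {t | 0 ≤ t ∧ ENNReal.ofReal t < m} := by
  have hpos := auxFunction_pos h ht
  have h4 : (4 : ℝ≥0∞) = 2 * 2 := by norm_num
  have key : ∀ r, 0 < r → ENNReal.ofReal r ≤ m →
      ENNReal.ofReal (2 * φ r) ≤ 4 * hφ.stieltjesMeasure {t | 0 ≤ t ∧ ENNReal.ofReal t < m} := by
    intro r hr hrm
    rw [ENNReal.ofReal_mul two_pos.le, ENNReal.ofReal_ofNat, h4, mul_assoc]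
    gcongr
    exact hφ.ofReal_le_two_mul_stieltjesMeasure hr hrm
  induction m with
  | top =>
    refine le_trans ?_ (key t ht le_top)
    calc _ ≤ ENNReal.ofReal (auxFunction φ t / t) * ∫⁻ s in Ioo 0 t, 1 := by
          gcongr; exact min_le_left _ _
      _ = ENNReal.ofReal (auxFunction φ t / t * min t t) := by
          rw [setLIntegral_one, Real.volume_Ioo, sub_zero, min_self,
            ENNReal.ofReal_mul (by positivity)]
      _ ≤ _ := ENNReal.ofReal_le_ofReal (auxFunction_div_mul_min_le hφ ht ht)
  | coe m =>
    rcases eq_or_ne m 0 with rfl | hm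
    · simp
    have hm' : (0 : ℝ) < m := by positivity
    refine le_trans ?_ (key m hm' (by simp))
    have hl := log_one_add_div_pos ht hm'
    calc _ ≤ ENNReal.ofReal (auxFunction φ t / t) *
          ENNReal.ofReal (2 * m * Real.log (1 + t / m)) := by
          gcongr
          simpa using lintegral_min_one_div_le hm' ht
      _ = ENNReal.ofReal (auxFunction φ t / t * (2 * m * Real.log (1 + t / m))) := by
          rw [← ENNReal.ofReal_mul (by positivity)]
      _ ≤ _ := by
          refine ENNReal.ofReal_le_ofReal ?_
          have h5 := auxFunction_le hφ ht hm'
          rw [le_div_iff₀ (by positivity)] at h5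
          rw [div_mul_eq_mul_div, div_le_iff₀ ht]
          linarith

/-- `f^{**}(s) = s⁻¹ ∫_0^s f^*`, expressed by the distribution function of `f`. -/
def maximalAverage (f : ℝ → ℝ≥0∞) (s : ℝ) : ℝ≥0∞ :=
  ∫⁻ u in Ioi (0 : ℝ), min 1 (distrib f u / ENNReal.ofReal s)

theorem maximalAverage_antitone (f : ℝ → ℝ≥0∞) : Antitone (maximalAverage f) := fun _ _ h =>
  lintegral_mono fun _ => min_le_min_left _ (ENNReal.div_le_div_left (ENNReal.ofReal_le_ofReal h) _)

theorem kFunctional_eq_mul_maximalAverage (f : ℝ → ℝ≥0∞) {s : ℝ} (hs : 0 < s) :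
    kFunctional f s = ENNReal.ofReal s * maximalAverage f s := by
  have hs0 : ENNReal.ofReal s ≠ 0 := by simpa using hs
  rw [maximalAverage, ← lintegral_const_mul' _ _ ENNReal.ofReal_ne_top]
  refine lintegral_congr fun u => ?_
  rw [mul_min, mul_one, ENNReal.mul_div_cancel hs0 ENNReal.ofReal_ne_top]

/-- Since `f^{**}` is decreasing, the level `l = f^{**}(t)` leaves an excess supported in `(0, t)`.
Finiteness is needed because levels are real numbers. -/
theorem kFunctional_maximalAverage_le (f : ℝ → ℝ≥0∞) {t : ℝ} (ht : 0 < t)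
    (hf : maximalAverage f t ≠ ∞) :
    kFunctional (maximalAverage f) t ≤ ∫⁻ s in Ioo 0 t, maximalAverage f s := by
  have hanti := maximalAverage_antitone f
  set F := maximalAverage f
  have hmeas : Measurable F := hanti.measurable
  refine (kFunctional_le hmeas.aemeasurable t (ENNReal.toReal_nonneg (a := F t))).trans ?_
  rw [ENNReal.ofReal_toReal hf]
  have h1 : ∫⁻ s, (F s - F t) ∂halfLine = ∫⁻ s in Ioo 0 t, (F s - F t) := by
    rw [halfLine, ← Ioo_union_Ici_eq_Ioi ht, lintegral_union measurableSet_Ici]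
    · have : ∀ s ∈ Ici t, F s - F t = 0 := fun s hs => tsub_eq_zero_of_le (hanti hs)
      rw [setLIntegral_congr_fun measurableSet_Ici this]
      simp
    · exact disjoint_left.2 fun x hx hx' => not_le.2 hx.2 hx'
  have h2 : ENNReal.ofReal t * F t = ∫⁻ s in Ioo 0 t, F t := by
    simp [mul_comm]
  rw [h1, h2, ← lintegral_add_left measurable_const]
  refine setLIntegral_mono' measurableSet_Ioo fun s hs => ?_
  rw [add_tsub_cancel_of_le (hanti hs.2.le)]

/-- Tonelli exchanges `s` with the level `u`, reducing to the single-level estimate. -/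
theorem QuasiConcave.auxFunction_mul_lintegral_maximalAverage_le {φ : ℝ → ℝ}
    (hφ : QuasiConcave φ)
    (h : ∃ C : ℝ, 0 < C ∧ ∀ t : ℝ, 0 < t → C * t * Real.log (1 + 1 / t) ≤ φ t) (f : ℝ → ℝ)
    {t : ℝ} (ht : 0 < t) :
    ENNReal.ofReal (auxFunction φ t / t) *
      ∫⁻ s in Ioo 0 t, maximalAverage (fun x => ‖f x‖ₑ) s ≤ 4 * hφ.lorentzNorm f := by
  have hD : Measurable (distrib fun x => ‖f x‖ₑ) := (distrib_antitone _).measurable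
  unfold maximalAverage
  rw [lintegral_lintegral_swap (f := fun s u =>
    min 1 (distrib (fun x => ‖f x‖ₑ) u / ENNReal.ofReal s))
    (by unfold Function.uncurry; fun_prop),
    ← lintegral_const_mul' _ _ ENNReal.ofReal_ne_top]
  calc _ ≤ ∫⁻ u in Ioi (0 : ℝ), 4 * hφ.stieltjesMeasure
        {t | 0 ≤ t ∧ ENNReal.ofReal t < distrib (fun x => ‖f x‖ₑ) u} :=
        lintegral_mono fun u => hφ.auxFunction_mul_lintegral_min_le h ht _
    _ = 4 * ∫⁻ u in Ioi (0 : ℝ), hφ.stieltjesMeasure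
        {t | 0 ≤ t ∧ ENNReal.ofReal t < distrib (fun x => ‖f x‖ₑ) u} :=
        lintegral_const_mul' _ _ (by norm_num)
    _ ≤ _ := by gcongr; exact hφ.lintegral_stieltjesMeasure_le_lorentzNorm f

/-- An infinite value at `t` would persist on all of `(0, t)` by monotonicity, against the preceding
estimate and `φ̃(t) > 0`. -/
theorem QuasiConcave.maximalAverage_lt_top {φ : ℝ → ℝ} (hφ : QuasiConcave φ)
    (h : ∃ C : ℝ, 0 < C ∧ ∀ t : ℝ, 0 < t → C * t * Real.log (1 + 1 / t) ≤ φ t) {f : ℝ → ℝ}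
    (hf : f ∈ hφ.lorentzSpace) {t : ℝ} (ht : 0 < t) :
    maximalAverage (fun x => ‖f x‖ₑ) t < ∞ := by
  have h1 := hφ.auxFunction_mul_lintegral_maximalAverage_le h f ht
  have hpos := div_pos (auxFunction_pos h ht) ht
  by_contra! hc
  have hF : ∫⁻ s in Ioo 0 t, maximalAverage (fun x => ‖f x‖ₑ) s = ∞ := by
    have : ∀ s ∈ Ioo 0 t, maximalAverage (fun x => ‖f x‖ₑ) s = ∞ := fun s hs =>
      top_le_iff.1 (hc.trans (maximalAverage_antitone _ hs.2.le))
    rw [setLIntegral_congr_fun measurableSet_Ioo this]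
    simp [ENNReal.top_mul, ht]
  rw [hF, ENNReal.mul_top (by simpa using hpos)] at h1
  exact not_lt.2 h1 (ENNReal.mul_lt_top (by norm_num) hf.2)

theorem lintegral_Ioc_enorm_le_mul_maximalAverage {f : ℝ → ℝ} (hf : AEMeasurable f halfLine)
    {s : ℝ} (hs : 0 < s) : ∫⁻ x in Ioc 0 s, ‖f x‖ₑ ≤
      ENNReal.ofReal s * maximalAverage (fun x => ‖f x‖ₑ) s := by
  rw [← kFunctional_eq_mul_maximalAverage _ hs]
  have hsub : Ioc 0 s ⊆ Ioi 0 := fun x hx => hx.1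
  have h1 : halfLine (Ioc 0 s) ≤ ENNReal.ofReal s := by
    rw [Measure.restrict_apply measurableSet_Ioc, inter_eq_left.2 hsub]
    simp
  have h2 := setLIntegral_le_kFunctional hf.enorm h1
  rwa [Measure.restrict_restrict measurableSet_Ioc, inter_eq_left.2 hsub] at h2

theorem QuasiConcave.intervalIntegrable_of_mem_lorentzSpace {φ : ℝ → ℝ} (hφ : QuasiConcave φ)
    (h : ∃ C : ℝ, 0 < C ∧ ∀ t : ℝ, 0 < t → C * t * Real.log (1 + 1 / t) ≤ φ t) {f : ℝ → ℝ}
    (hf : f ∈ hφ.lorentzSpace) {t : ℝ} (ht : 0 < t) : IntervalIntegrable f volume 0 t := by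
  rw [intervalIntegrable_iff_integrableOn_Ioc_of_le ht.le]
  refine ⟨(hf.1.mono_measure (Measure.restrict_mono (fun x hx => hx.1) le_rfl)).aestronglyMeasurable,
    ?_⟩
  exact lt_of_le_of_lt (lintegral_Ioc_enorm_le_mul_maximalAverage hf.1 ht)
    (ENNReal.mul_lt_top ENNReal.ofReal_lt_top (hφ.maximalAverage_lt_top h hf ht))

theorem enorm_hardy_le_maximalAverage {f : ℝ → ℝ} (hf : AEMeasurable f halfLine) {s : ℝ}
    (hs : 0 < s) : ‖hardy f s‖ₑ ≤ maximalAverage (fun x => ‖f x‖ₑ) s := by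
  have hs0 : ENNReal.ofReal s ≠ 0 := by simpa using hs
  have h1 : ‖(1 / s : ℝ)‖ₑ = (ENNReal.ofReal s)⁻¹ := by
    rw [Real.enorm_of_nonneg (by positivity), one_div, ENNReal.ofReal_inv_of_pos hs]
  rw [hardy, enorm_mul, h1, intervalIntegral.integral_of_le hs.le]
  calc _ ≤ (ENNReal.ofReal s)⁻¹ * (ENNReal.ofReal s * maximalAverage (fun x => ‖f x‖ₑ) s) := by
        gcongr
        exact (enorm_integral_le_lintegral_enorm _).trans
          (lintegral_Ioc_enorm_le_mul_maximalAverage hf hs)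
    _ = _ := by
        rw [← mul_assoc, ENNReal.inv_mul_cancel hs0 ENNReal.ofReal_ne_top, one_mul]

/-- The Hardy operator is bounded from `Λ_φ` to the Marcinkiewicz space of `φ̃`. -/
theorem QuasiConcave.hardyBounded_auxMarcinkiewicz {φ : ℝ → ℝ} (hφ : QuasiConcave φ)
    (h : ∃ C : ℝ, 0 < C ∧ ∀ t : ℝ, 0 < t → C * t * Real.log (1 + 1 / t) ≤ φ t) :
    HardyBounded hφ (hφ.auxMarcinkiewicz h) := by
  refine ⟨4, fun f hf => ⟨fun t ht => hφ.intervalIntegrable_of_mem_lorentzSpace h hf ht, ?_⟩⟩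
  rw [hφ.auxMarcinkiewicz_norm]
  refine iSup_le fun t => ?_
  have ht : 0 < (t : ℝ) := t.2
  refine le_trans ?_ (hφ.auxFunction_mul_lintegral_maximalAverage_le h f ht)
  gcongr
  refine le_trans (kFunctional_mono ?_ _)
    (kFunctional_maximalAverage_le _ ht (hφ.maximalAverage_lt_top h hf ht).ne)
  exact (ae_restrict_iff' measurableSet_Ioi).2
    (Filter.Eventually.of_forall fun s hs => enorm_hardy_le_maximalAverage hf.1 hs)

/-! ### The test functions `χ_(0,r)`. -/

theorem decRearr_indicator_le_one (r t : ℝ) :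
    decRearr ((Ioo 0 r).indicator fun _ => 1) t ≤ 1 := by
  refine sInf_le ?_
  have : {x | (1 : ℝ≥0∞) < ‖(Ioo 0 r).indicator (fun _ => (1 : ℝ)) x‖ₑ} = ∅ := by
    ext x
    by_cases hx : x ∈ Ioo 0 r <;> simp [hx]
  rw [mem_ofPred_eq, this]
  simp

theorem decRearr_indicator_eq_zero {r t : ℝ} (hrt : r ≤ t) :
    decRearr ((Ioo 0 r).indicator fun _ => 1) t = 0 := by
  refine le_antisymm (sInf_le ?_) bot_le
  refine (measure_mono (t := Ioo 0 r) fun x hx => ?_).trans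
    ((halfLine_Ioo_zero r).trans_le (ENNReal.ofReal_le_ofReal hrt))
  by_contra hx'
  rw [mem_ofPred_eq, indicator_of_notMem hx'] at hx
  simp at hx

theorem QuasiConcave.lorentzNorm_indicator_le {φ : ℝ → ℝ} (hφ : QuasiConcave φ) {r : ℝ}
    (hr : 0 < r) :
    hφ.lorentzNorm ((Ioo 0 r).indicator fun _ => 1) ≤ ENNReal.ofReal (2 * φ r) := by
  refine le_trans ?_ (hφ.stieltjesMeasure_Icc_le hr)
  rw [← lintegral_indicator_one measurableSet_Icc, lorentzNorm,
    ← lintegral_indicator measurableSet_Ici]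
  refine lintegral_mono fun t => ?_
  by_cases h0 : 0 ≤ t
  · rw [indicator_of_mem (mem_Ici.2 h0)]
    by_cases h1 : t ≤ r
    · rw [indicator_of_mem (show t ∈ Icc 0 r from ⟨h0, h1⟩)]
      exact decRearr_indicator_le_one r t
    · rw [decRearr_indicator_eq_zero (not_le.1 h1).le]
      exact bot_le
  · rw [indicator_of_notMem (by simpa using h0)]
    exact bot_le

theorem QuasiConcave.indicator_mem_lorentzSpace {φ : ℝ → ℝ} (hφ : QuasiConcave φ) {r : ℝ}
    (hr : 0 < r) : ((Ioo 0 r).indicator fun _ => 1) ∈ hφ.lorentzSpace :=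
  ⟨(measurable_const.indicator measurableSet_Ioo).aemeasurable,
    lt_of_le_of_lt (hφ.lorentzNorm_indicator_le hr) ENNReal.ofReal_lt_top⟩

theorem hardy_indicator {r t : ℝ} (hr : 0 < r) (ht : 0 < t) :
    hardy ((Ioo 0 r).indicator fun _ => 1) t = min t r / t := by
  have h : ∫ x in (0 : ℝ)..t, (Ioo 0 r).indicator (fun _ => (1 : ℝ)) x = min t r := by
    rw [intervalIntegral.integral_of_le ht.le, setIntegral_indicator measurableSet_Ioo]
    simp only [setIntegral_const, smul_eq_mul, mul_one]
    have : volume (Ioc 0 t ∩ Ioo 0 r) = volume (Ioc 0 (min t r)) := by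
      have h2 : Ioc 0 (min t r) = Ioc 0 t ∩ Ioc 0 r := by rw [Ioc_inter_Ioc, max_self]
      rw [h2]
      exact measure_congr ((ae_eq_refl (Ioc 0 t)).inter Ioo_ae_eq_Ioc)
    rw [measureReal_def, this, Real.volume_Ioc, sub_zero, ENNReal.toReal_ofReal (lt_min ht hr).le]
  rw [hardy, h, one_div_mul_eq_div]

theorem aemeasurable_hardy_indicator {r : ℝ} (hr : 0 < r) :
    AEMeasurable (fun t => ‖hardy ((Ioo 0 r).indicator fun _ => 1) t‖ₑ) halfLine := by
  have hm : Measurable fun t : ℝ => ‖min t r / t‖ₑ := by fun_prop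
  refine hm.aemeasurable.congr ((ae_restrict_iff' measurableSet_Ioi).2
    (Filter.Eventually.of_forall fun t ht => ?_))
  simp only [hardy_indicator hr ht]

/-! ### Cyclic averaging and the upper bound for the fundamental function. -/

/-- The step function on `(0, t)` with value `a (i + j)` on the `i`-th of `n` intervals of equal
length. -/
def cyclicStep {n : ℕ} [NeZero n] (t : ℝ) (a : Fin n → ℝ≥0∞) (j : Fin n) (x : ℝ) : ℝ≥0∞ :=
  ∑ i : Fin n, (Ico (t / n * i) (t / n * (i + 1))).indicator (fun _ => a (i + j)) x

theorem measurable_cyclicStep {n : ℕ} [NeZero n] (t : ℝ) (a : Fin n → ℝ≥0∞) (j : Fin n) :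
    Measurable (cyclicStep t a j) :=
  Finset.measurable_sum _ fun _ _ => measurable_const.indicator measurableSet_Ico

theorem cyclicStep_eq {n : ℕ} [NeZero n] {t : ℝ} (ht : 0 < t) (a : Fin n → ℝ≥0∞) (j i : Fin n)
    {x : ℝ} (hx : x ∈ Ico (t / n * i) (t / n * (i + 1))) : cyclicStep t a j x = a (i + j) := by
  have hn : 0 < t / n := div_pos ht (Nat.cast_pos.2 (NeZero.pos n))
  rw [cyclicStep, Finset.sum_eq_single i, indicator_of_mem hx]
  · intro k _ hki
    refine indicator_of_notMem (fun hk => hki ?_) _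
    have h1 := lt_of_mul_lt_mul_left (hx.1.trans_lt hk.2) hn.le
    have h2 := lt_of_mul_lt_mul_left (hk.1.trans_lt hx.2) hn.le
    norm_cast at h1 h2
    exact Fin.ext (by omega)
  · simp

theorem exists_mem_Ico_of_mem_Ico {n : ℕ} [NeZero n] {t : ℝ} (ht : 0 < t) {x : ℝ}
    (hx : x ∈ Ico 0 t) : ∃ i : Fin n, x ∈ Ico (t / n * i) (t / n * (i + 1)) := by
  have hn0 : (0 : ℝ) < n := Nat.cast_pos.2 (NeZero.pos n)
  have hn : 0 < t / n := div_pos ht hn0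
  have hy : 0 ≤ x / (t / n) := div_nonneg hx.1 hn.le
  refine ⟨⟨⌊x / (t / n)⌋₊, ?_⟩, ?_, ?_⟩
  · rw [Nat.floor_lt hy, div_lt_iff₀ hn, mul_div_cancel₀ _ hn0.ne']
    exact hx.2
  · rw [mul_comm, ← le_div_iff₀ hn]
    exact Nat.floor_le hy
  · rw [mul_comm, ← div_lt_iff₀ hn]
    exact Nat.lt_floor_add_one _

theorem cyclicStep_eq_zero {n : ℕ} [NeZero n] {t : ℝ} (ht : 0 < t) (a : Fin n → ℝ≥0∞)
    (j : Fin n) {x : ℝ} (hx : x ∉ Ico 0 t) : cyclicStep t a j x = 0 := by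
  have hn0 : (0 : ℝ) < n := Nat.cast_pos.2 (NeZero.pos n)
  have hn : 0 < t / n := div_pos ht hn0
  refine Finset.sum_eq_zero fun i _ => indicator_of_notMem (fun hi => hx ⟨?_, ?_⟩) _
  · exact le_trans (by positivity) hi.1
  · refine hi.2.trans_le ?_
    have : ((i : ℕ) : ℝ) + 1 ≤ n := by exact_mod_cast i.2
    calc t / n * (i + 1) ≤ t / n * n := by gcongr
      _ = t := div_mul_cancel₀ _ hn0.ne'

/-- Addition of `j` in `Fin n` is a permutation, so all cyclic shifts are equimeasurable. -/
theorem halfLine_lt_cyclicStep {n : ℕ} [NeZero n] {t : ℝ} (ht : 0 < t) (a : Fin n → ℝ≥0∞)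
    (j : Fin n) (s : ℝ≥0∞) :
    halfLine {x | s < cyclicStep t a j x} =
      ∑ i : Fin n, if s < a i then ENNReal.ofReal (t / n) else 0 := by
  have hn : 0 < t / n := div_pos ht (Nat.cast_pos.2 (NeZero.pos n))
  have hset : {x | s < cyclicStep t a j x} =
      ⋃ i ∈ (Finset.univ : Finset (Fin n)).filter (fun i => s < a (i + j)),
        Ico (t / n * i) (t / n * (i + 1)) := by
    ext x
    simp only [mem_ofPred_eq, mem_iUnion, Finset.mem_filter, Finset.mem_univ, true_and,
      exists_prop]
    constructor
    · intro hx
      have hxt : x ∈ Ico 0 t := by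
        by_contra hxt
        simp [cyclicStep_eq_zero ht a j hxt] at hx
      obtain ⟨i, hi⟩ := exists_mem_Ico_of_mem_Ico (n := n) ht hxt
      exact ⟨i, by rwa [cyclicStep_eq ht a j i hi] at hx, hi⟩
    · rintro ⟨i, hi, hx⟩
      rwa [cyclicStep_eq ht a j i hx]
  rw [hset, measure_biUnion_finset]
  · have : ∀ i : Fin n, halfLine (Ico (t / n * i) (t / n * (i + 1))) = ENNReal.ofReal (t / n) := by
      intro i
      -- The interval with `i = 0` contains the endpoint `0`, hence the passage to `[0, ∞)`.
      rw [halfLine, Measure.restrict_congr_set Ioi_ae_eq_Ici, Measure.restrict_apply measurableSet_Ico,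
        inter_eq_left.2 fun x hx => mem_Ici.2 (le_trans (by positivity) hx.1), Real.volume_Ico]
      congr 1; ring
    simp only [this]
    rw [Finset.sum_filter, ← Equiv.sum_comp (Equiv.addRight j)
      (fun i => if s < a i then ENNReal.ofReal (t / n) else 0)]
    rfl
  · intro i _ k _ hik
    refine disjoint_left.2 fun x hi hk => hik ?_
    have h1 := lt_of_mul_lt_mul_left (hi.1.trans_lt hk.2) hn.le
    have h2 := lt_of_mul_lt_mul_left (hk.1.trans_lt hi.2) hn.le
    norm_cast at h1 h2
    exact Fin.ext (by omega)
  · exact fun i _ => measurableSet_Ico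

theorem RISpace.norm_sum_le (Y : RISpace) {ι : Type*} (s : Finset ι) (f : ι → ℝ → ℝ≥0∞)
    (hf : ∀ i, AEMeasurable (f i) halfLine) :
    Y.norm (fun x => ∑ i ∈ s, f i x) ≤ ∑ i ∈ s, Y.norm (f i) := by
  classical
  induction s using Finset.induction_on with
  | empty =>
    simp only [Finset.sum_empty]
    exact ((Y.norm_eq_zero_iff _ aemeasurable_const).2 (Filter.EventuallyEq.refl _ _)).le
  | insert i s his ih =>
    simp only [Finset.sum_insert his]
    exact (Y.norm_add_le _ _ (hf i) (Finset.aemeasurable_fun_sum _ fun i _ => hf i)).trans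
      (add_le_add_right ih _)

/-- Averaging over the cyclic permutations of a step function on `n` intervals of equal length. -/
theorem RISpace.sum_mul_norm_indicator_le (Y : RISpace) {n : ℕ} [NeZero n] {t : ℝ} (ht : 0 < t)
    (a : Fin n → ℝ≥0) :
    ((∑ i, a i : ℝ≥0) : ℝ≥0∞) * Y.norm ((Ioo 0 t).indicator fun _ => 1) ≤
      n * Y.norm (cyclicStep t (fun i => (a i : ℝ≥0∞)) 0) := by
  have hfin : ∀ j, ∀ᵐ x ∂halfLine, cyclicStep t (fun i => (a i : ℝ≥0∞)) j x < ∞ := fun j =>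
    Filter.Eventually.of_forall fun x => ENNReal.sum_lt_top.2 fun i _ => by
      unfold indicator; split_ifs <;> simp
  have hind : AEMeasurable ((Ioo 0 t).indicator fun _ => (1 : ℝ≥0∞)) halfLine :=
    (measurable_const.indicator measurableSet_Ioo).aemeasurable
  have heq : ∀ j, Y.norm (cyclicStep t (fun i => (a i : ℝ≥0∞)) j) =
      Y.norm (cyclicStep t (fun i => (a i : ℝ≥0∞)) 0) := fun j =>
    Y.norm_eq_of_equimeasurable _ _ (measurable_cyclicStep _ _ _).aemeasurable
      (measurable_cyclicStep _ _ _).aemeasurable (hfin j) (hfin 0) fun s => by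
        rw [halfLine_lt_cyclicStep ht, halfLine_lt_cyclicStep ht]
  rw [← Y.norm_smul _ _ hind]
  calc Y.norm (fun x => ((∑ i, a i : ℝ≥0) : ℝ≥0∞) * (Ioo 0 t).indicator (fun _ => 1) x)
      ≤ Y.norm (fun x => ∑ j : Fin n, cyclicStep t (fun i => (a i : ℝ≥0∞)) j x) := by
        refine Y.norm_mono _ _ (hind.const_mul _) (Finset.aemeasurable_fun_sum _ fun j _ =>
          (measurable_cyclicStep _ _ _).aemeasurable) (Filter.Eventually.of_forall fun x => ?_)
        by_cases hx : x ∈ Ioo 0 t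
        · obtain ⟨i, hi⟩ := exists_mem_Ico_of_mem_Ico (n := n) ht ⟨hx.1.le, hx.2⟩
          simp only [cyclicStep_eq ht _ _ i hi, indicator_of_mem hx, mul_one]
          rw [ENNReal.ofNNReal_finsetSum, ← Equiv.sum_comp (Equiv.addLeft i)]
          rfl
        · simp [indicator_of_notMem hx]
    _ ≤ ∑ j : Fin n, Y.norm (cyclicStep t (fun i => (a i : ℝ≥0∞)) j) :=
        Y.norm_sum_le _ _ fun j => (measurable_cyclicStep _ _ _).aemeasurable
    _ = _ := by simp [heq]

/-- On the `i`-th interval `x < (i+1) t/n ≤ (i+1) r`, and trivially `x ≤ (i+1) x`. -/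
theorem cyclicStep_harmonic_le_hardy {r t : ℝ} (hr : 0 < r) (ht : 0 < t) {n : ℕ} [NeZero n]
    (hn : t / r ≤ n) {x : ℝ} (hx : 0 < x) :
    cyclicStep t (fun i : Fin n => (((i + 1 : ℝ≥0)⁻¹ : ℝ≥0) : ℝ≥0∞)) 0 x ≤
      ‖hardy ((Ioo 0 r).indicator fun _ => 1) x‖ₑ := by
  have hn0 : (0 : ℝ) < n := Nat.cast_pos.2 (NeZero.pos n)
  by_cases hxt : x ∈ Ico 0 t
  · obtain ⟨i, hi⟩ := exists_mem_Ico_of_mem_Ico (n := n) ht hxt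
    rw [cyclicStep_eq ht _ _ i hi, add_zero, hardy_indicator hr hx,
      Real.enorm_of_nonneg (div_nonneg (lt_min hx hr).le hx.le), ← ENNReal.ofReal_coe_nnreal]
    refine ENNReal.ofReal_le_ofReal ?_
    push_cast
    rw [inv_eq_one_div, div_le_div_iff₀ (by positivity) hx, one_mul, min_mul_of_nonneg _ _
      (by positivity)]
    refine le_min ?_ ?_
    · have : (0 : ℝ) ≤ (i : ℕ) := by positivity
      nlinarith
    · refine hi.2.le.trans ?_
      gcongr
      rw [div_le_iff₀ hn0]
      rw [div_le_iff₀ hr] at hn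
      linarith
  · rw [cyclicStep_eq_zero ht _ _ hxt]
    exact bot_le

theorem log_le_sum_inv (n : ℕ) :
    Real.log (n + 1) ≤ ((∑ i : Fin n, (i + 1 : ℝ≥0)⁻¹ : ℝ≥0) : ℝ) := by
  have h := log_add_one_le_harmonic n
  rw [harmonic, ← Fin.sum_univ_eq_sum_range (fun i => ((i + 1 : ℕ) : ℚ)⁻¹)] at h
  push_cast at h ⊢
  exact h

/-- The explicit linear dependence on `C`, uniform over all `Y`, is what makes the supremum of norms
finite in the existence proof. -/
theorem HardyBounded.norm_indicator_le {φ : ℝ → ℝ} {hφ : QuasiConcave φ} {Y : RISpace} {C : ℝ≥0}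
    (hC : ∀ f ∈ hφ.lorentzSpace, Y.norm (fun t => ‖hardy f t‖ₑ) ≤ C * hφ.lorentzNorm f)
    {t r : ℝ} (ht : 0 < t) (hr : 0 < r) :
    Y.norm ((Ioo 0 t).indicator fun _ => 1) ≤
      ENNReal.ofReal (4 * C * (t * φ r / (r * Real.log (1 + t / r)))) := by
  have htr : 0 < t / r := div_pos ht hr
  have hφr := hφ.pos r hr
  have hlog := log_one_add_div_pos ht hr
  set n := ⌈t / r⌉₊
  have hn : t / r ≤ n := Nat.le_ceil _
  have : NeZero n := ⟨(Nat.ceil_pos.2 htr).ne'⟩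
  have hlt : (n : ℝ) < t / r + 1 := Nat.ceil_lt_add_one htr.le
  have hind : Y.norm ((Ioo 0 t).indicator fun _ => 1) < ∞ :=
    Y.norm_indicator_lt_top _ measurableSet_Ioo
      (by rw [halfLine_Ioo_zero]; exact ENNReal.ofReal_lt_top)
  have h1 := Y.sum_mul_norm_indicator_le ht fun i : Fin n => (i + 1 : ℝ≥0)⁻¹
  have h2 : Y.norm (cyclicStep t (fun i : Fin n => (((i + 1 : ℝ≥0)⁻¹ : ℝ≥0) : ℝ≥0∞)) 0) ≤
      C * ENNReal.ofReal (2 * φ r) :=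
    calc _ ≤ Y.norm (fun x => ‖hardy ((Ioo 0 r).indicator fun _ => 1) x‖ₑ) :=
          Y.norm_mono _ _ (measurable_cyclicStep _ _ _).aemeasurable
            (aemeasurable_hardy_indicator hr) ((ae_restrict_iff' measurableSet_Ioi).2
              (Filter.Eventually.of_forall fun x hx => cyclicStep_harmonic_le_hardy hr ht hn hx))
      _ ≤ C * hφ.lorentzNorm ((Ioo 0 r).indicator fun _ => 1) :=
          hC _ (hφ.indicator_mem_lorentzSpace hr)
      _ ≤ _ := by gcongr; exact hφ.lorentzNorm_indicator_le hr
  have h3 := h1.trans (mul_le_mul_right h2 _)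
  rw [← ENNReal.ofReal_toReal hind.ne] at h3 ⊢
  set x := (Y.norm ((Ioo 0 t).indicator fun _ => 1)).toReal
  have hx : 0 ≤ x := ENNReal.toReal_nonneg
  rw [← ENNReal.ofReal_coe_nnreal, ← ENNReal.ofReal_coe_nnreal (p := C),
    ← ENNReal.ofReal_natCast, ← ENNReal.ofReal_mul (by positivity),
    ← ENNReal.ofReal_mul (by positivity), ← ENNReal.ofReal_mul (by positivity),
    ENNReal.ofReal_le_ofReal_iff (by positivity)] at h3
  have h4 : Real.log (n + 1) * x ≤ n * (C * (2 * φ r)) :=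
    (mul_le_mul_of_nonneg_right (log_le_sum_inv n) hx).trans h3
  refine ENNReal.ofReal_le_ofReal ?_
  rw [← mul_div_assoc, le_div_iff₀ (by positivity)]
  suffices x * Real.log (1 + t / r) ≤ 4 * C * φ r * (t / r) by
    calc x * (r * Real.log (1 + t / r)) = r * (x * Real.log (1 + t / r)) := by ring
      _ ≤ r * (4 * C * φ r * (t / r)) := by gcongr
      _ = _ := by field_simp
  -- For `r ≤ t`, `n ≤ 2t/r`. For `t ≤ r`, `n = 1`, and `log 2 ≥ 1/2` with `log (1 + t/r) ≤ t/r`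
  -- gives the same constant `4`.
  rcases le_total r t with hrt | hrt
  · have h5 : 1 ≤ t / r := (one_le_div hr).2 hrt
    calc x * Real.log (1 + t / r) ≤ x * Real.log (n + 1) := by
          gcongr x * ?_
          exact Real.log_le_log (by positivity) (by linarith)
      _ = Real.log (n + 1) * x := mul_comm _ _
      _ ≤ n * (C * (2 * φ r)) := h4
      _ ≤ (2 * (t / r)) * (C * (2 * φ r)) := by gcongr; linarith
      _ = _ := by ring
  · have h5 : t / r ≤ 1 := (div_le_one hr).2 hrt
    have hn1 : n = 1 := le_antisymm (Nat.ceil_le.2 (by simpa using h5)) (Nat.ceil_pos.2 htr)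
    have hl2 : (1 / 2 : ℝ) ≤ Real.log 2 := by linarith [Real.log_two_gt_d9]
    rw [hn1, Nat.cast_one, one_mul, one_add_one_eq_two] at h4
    have h6 : 1 / 2 * x ≤ Real.log 2 * x := by gcongr
    have h7 : Real.log (1 + t / r) ≤ t / r := by
      linarith [Real.log_le_sub_one_of_pos (show 0 < 1 + t / r by positivity)]
    calc x * Real.log (1 + t / r) ≤ x * (t / r) := by gcongr
      _ ≤ _ := by gcongr; linarith

/-! ### Inclusions between rearrangement invariant spaces. -/

theorem RISpace.norm_congr (Y : RISpace) {f g : ℝ → ℝ≥0∞} (hf : AEMeasurable f halfLine)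
    (h : f =ᵐ[halfLine] g) : Y.norm f = Y.norm g :=
  le_antisymm (Y.norm_mono _ _ hf (hf.congr h) h.le) (Y.norm_mono _ _ (hf.congr h) hf h.symm.le)

/-- Local integrability on each `(0, n)`. This passes from `[0, ∞]`-valued functions, on which norms
act, to the real-valued elements of the carrier. -/
theorem RISpace.ae_lt_top (Y : RISpace) {f : ℝ → ℝ≥0∞} (hf : AEMeasurable f halfLine)
    (h : Y.norm f < ∞) : ∀ᵐ x ∂halfLine, f x < ∞ := by
  have hU : (⋃ n : ℕ, Ioo (0 : ℝ) n) = Ioi 0 := by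
    ext x
    simp only [mem_iUnion, mem_Ioo, mem_Ioi]
    exact ⟨fun ⟨_, hn⟩ => hn.1, fun hx => (exists_nat_gt x).imp fun n hn => ⟨hx, hn⟩⟩
  rw [halfLine, ← hU, ae_restrict_iUnion_iff]
  intro n
  have hsub : Ioo (0 : ℝ) n ⊆ Ioi 0 := fun x hx => hx.1
  obtain ⟨C, hC⟩ := Y.lintegral_le (Ioo 0 n) measurableSet_Ioo
    (by rw [halfLine_Ioo_zero]; exact ENNReal.ofReal_lt_top)
  have h1 := hC f hf
  rw [Measure.restrict_restrict measurableSet_Ioo, inter_eq_left.2 hsub] at h1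
  exact ae_lt_top' (hf.mono_measure (Measure.restrict_mono hsub le_rfl))
    (lt_of_le_of_lt h1 (ENNReal.mul_lt_top ENNReal.coe_lt_top h)).ne

/-- The Fatou property upgrades finite subadditivity to countable subadditivity. -/
theorem RISpace.norm_tsum_le (Y : RISpace) (f : ℕ → ℝ → ℝ≥0∞)
    (hf : ∀ n, AEMeasurable (f n) halfLine) :
    Y.norm (fun x => ∑' n, f n x) ≤ ∑' n, Y.norm (f n) := by
  simp only [ENNReal.tsum_eq_iSup_nat]
  rw [Y.norm_iSup _ (fun n => Finset.aemeasurable_fun_sum _ fun i _ => hf i)]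
  · exact iSup_mono fun n => Y.norm_sum_le _ _ hf
  · refine Filter.Eventually.of_forall fun x m n hmn => ?_
    exact Finset.sum_le_sum_of_subset (Finset.range_mono hmn)

theorem RISpace.norm_lt_top_of_carrier_subset {Y Z : RISpace} (h : Y.carrier ⊆ Z.carrier)
    {g : ℝ → ℝ≥0∞} (hg : AEMeasurable g halfLine) (hY : Y.norm g < ∞) : Z.norm g < ∞ := by
  have heq : g =ᵐ[halfLine] fun x => ‖(g x).toReal‖ₑ := by
    filter_upwards [Y.ae_lt_top hg hY] with x hx
    rw [Real.enorm_of_nonneg ENNReal.toReal_nonneg, ENNReal.ofReal_toReal hx.ne]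
  rw [Z.norm_congr hg heq]
  exact (h (⟨hg.ennreal_toReal, by rwa [← Y.norm_congr hg heq]⟩ :
    (fun x => (g x).toReal) ∈ Y.carrier)).2

/-- An inclusion between rearrangement invariant spaces is bounded. -/
theorem RISpace.exists_norm_le_of_carrier_subset {Y Z : RISpace} (h : Y.carrier ⊆ Z.carrier) :
    ∃ C : ℝ≥0, ∀ f, AEMeasurable f halfLine → Z.norm f ≤ C * Y.norm f := by
  by_contra! hcon
  -- Gliding hump: with `‖f_n‖_Z > 4^n ‖f_n‖_Y`, the sum of `2^{-n} f_n / ‖f_n‖_Y` has finite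
  -- `Y`-norm but `Z`-norm at least `2^n` for every `n`.
  choose f hf hlt using fun n : ℕ => hcon (4 ^ n)
  have htop : ∀ n, Y.norm (f n) ≠ ∞ := fun n hn => by
    have := hlt n
    rw [hn, ENNReal.mul_top (by simp)] at this
    exact not_top_lt this
  have hzero : ∀ n, Y.norm (f n) ≠ 0 := fun n hn => by
    have := hlt n
    rw [(Z.norm_eq_zero_iff _ (hf n)).2 ((Y.norm_eq_zero_iff _ (hf n)).1 hn)] at this
    exact not_lt_bot this
  set a : ℕ → ℝ≥0 := fun n => 2⁻¹ ^ n * (Y.norm (f n)).toNNReal⁻¹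
  have ha : ∀ n, (a n : ℝ≥0∞) * Y.norm (f n) = 2⁻¹ ^ n := fun n => by
    have h0 : (Y.norm (f n)).toNNReal ≠ 0 := by
      rw [Ne, ENNReal.toNNReal_eq_zero_iff]
      exact fun h => h.elim (hzero n) (htop n)
    rw [← ENNReal.coe_toNNReal (htop n), ← ENNReal.coe_mul, mul_assoc, inv_mul_cancel₀ h0, mul_one,
      ENNReal.coe_pow, ENNReal.coe_inv two_ne_zero, ENNReal.coe_ofNat]
  have hmeas : ∀ n, AEMeasurable (fun x => (a n : ℝ≥0∞) * f n x) halfLine :=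
    fun n => (hf n).const_mul _
  have hgm : AEMeasurable (fun x => ∑' n, (a n : ℝ≥0∞) * f n x) halfLine :=
    AEMeasurable.tsum hmeas
  have hY : Y.norm (fun x => ∑' n, (a n : ℝ≥0∞) * f n x) < ∞ := by
    refine lt_of_le_of_lt (Y.norm_tsum_le _ hmeas) ?_
    simp only [Y.norm_smul _ _ (hf _), ha, ENNReal.tsum_geometric]
    simp
  obtain ⟨n, hn⟩ := ENNReal.exists_nat_gt (norm_lt_top_of_carrier_subset h hgm hY).ne
  refine not_le.2 hn ?_
  calc (n : ℝ≥0∞) ≤ 2 ^ n := by exact_mod_cast Nat.lt_two_pow_self.le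
    _ = 4 ^ n * 2⁻¹ ^ n := by
        rw [show (4 : ℝ≥0∞) = 2 * 2 by norm_num, mul_pow, mul_assoc, ← mul_pow 2 2⁻¹,
          ENNReal.mul_inv_cancel two_ne_zero ENNReal.ofNat_ne_top, one_pow, mul_one]
    _ = a n * (((4 ^ n : ℝ≥0) : ℝ≥0∞) * Y.norm (f n)) := by
        rw [mul_left_comm, ha, ENNReal.coe_pow, ENNReal.coe_ofNat]
    _ ≤ a n * Z.norm (f n) := by gcongr; exact (hlt n).le
    _ = Z.norm (fun x => a n * f n x) := (Z.norm_smul _ _ (hf n)).symm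
    _ ≤ _ := Z.norm_mono _ _ (hmeas n) hgm (Filter.Eventually.of_forall fun x =>
        ENNReal.le_tsum (f := fun n => (a n : ℝ≥0∞) * f n x) n)

/-! ### Existence of the optimal range. -/

/-- The supremum of a family of multiples of rearrangement invariant norms, provided that it is
finite on the characteristic functions of sets of finite measure. -/
def RISpace.weightedSup {ι : Type} [Nonempty ι] (Z : ι → RISpace) (c : ι → ℝ≥0)
    (hc : ∀ i, c i ≠ 0)
    (hfin : ∀ E, MeasurableSet E → halfLine E < ∞ →
      ⨆ i, (c i : ℝ≥0∞) * (Z i).norm (E.indicator fun _ => 1) < ∞) : RISpace where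
  norm f := ⨆ i, c i * (Z i).norm f
  norm_eq_zero_iff f hf := by
    have hc' : ∀ i, (c i : ℝ≥0∞) ≠ 0 := fun i => by simpa using hc i
    simp [ENNReal.iSup_eq_zero, hc', (Z _).norm_eq_zero_iff f hf]
  norm_smul a f hf := by
    rw [ENNReal.mul_iSup]
    refine iSup_congr fun i => ?_
    rw [(Z i).norm_smul a f hf, mul_left_comm]
  norm_add_le f g hf hg := by
    refine iSup_le fun i => ?_
    calc (c i : ℝ≥0∞) * (Z i).norm (fun x => f x + g x)
        ≤ c i * ((Z i).norm f + (Z i).norm g) := by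
          gcongr; exact (Z i).norm_add_le f g hf hg
      _ = c i * (Z i).norm f + c i * (Z i).norm g := mul_add _ _ _
      _ ≤ _ := add_le_add
          (le_iSup (fun i => (c i : ℝ≥0∞) * (Z i).norm f) i)
          (le_iSup (fun i => (c i : ℝ≥0∞) * (Z i).norm g) i)
  norm_mono f g hf hg h := iSup_mono fun i => by
    gcongr
    exact (Z i).norm_mono f g hf hg h
  norm_iSup f hf hmono := by
    rw [iSup_comm]
    refine iSup_congr fun i => ?_
    rw [(Z i).norm_iSup f hf hmono, ENNReal.mul_iSup]
  norm_indicator_lt_top := hfin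
  lintegral_le E hE hEt := by
    obtain ⟨i⟩ := ‹Nonempty ι›
    obtain ⟨C, hC⟩ := (Z i).lintegral_le E hE hEt
    refine ⟨C * (c i)⁻¹, fun f hf => (hC f hf).trans ?_⟩
    calc (C : ℝ≥0∞) * (Z i).norm f
        = ((C * (c i)⁻¹ : ℝ≥0) : ℝ≥0∞) * (c i * (Z i).norm f) := by
          rw [← mul_assoc, ← ENNReal.coe_mul, mul_assoc, inv_mul_cancel₀ (hc i), mul_one]
      _ ≤ _ := by
          gcongr
          exact le_iSup (fun i => (c i : ℝ≥0∞) * (Z i).norm f) i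
  norm_eq_of_equimeasurable f g hf hg hf' hg' h :=
    iSup_congr fun i => by rw [(Z i).norm_eq_of_equimeasurable f g hf hg hf' hg' h]

theorem RISpace.norm_indicator_le (Z : RISpace) {E : Set ℝ} (hE : MeasurableSet E)
    (hEt : halfLine E < ∞) {m : ℝ} (hm : (halfLine E).toReal ≤ m) :
    Z.norm (E.indicator fun _ => 1) ≤ Z.norm ((Ioo 0 m).indicator fun _ => 1) := by
  rw [Z.fundamentalFunction_spec _ E hE (ENNReal.ofReal_toReal hEt.ne).symm,
    ← Z.fundamentalFunction_spec _ _ measurableSet_Ioo (halfLine_Ioo_zero _)]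
  refine Z.norm_mono _ _ (measurable_const.indicator measurableSet_Ioo).aemeasurable
    (measurable_const.indicator measurableSet_Ioo).aemeasurable
    (Filter.Eventually.of_forall fun x => ?_)
  exact indicator_le_indicator_of_subset (Ioo_subset_Ioo_right hm) (fun _ => zero_le_one) x

/-- The spaces `Z` with a nonzero bound for the norm of the Hardy operator from `Λ_φ` to `Z`. -/
def QuasiConcave.HardyTarget {φ : ℝ → ℝ} (hφ : QuasiConcave φ) : Type :=
  {p : RISpace × ℝ≥0 // p.2 ≠ 0 ∧
    ∀ f ∈ hφ.lorentzSpace, p.1.norm (fun t => ‖hardy f t‖ₑ) ≤ p.2 * hφ.lorentzNorm f}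

theorem HardyBounded.exists_hardyTarget {φ : ℝ → ℝ} {hφ : QuasiConcave φ} {Z : RISpace}
    (hZ : HardyBounded hφ Z) : ∃ p : hφ.HardyTarget, p.1.1 = Z := by
  obtain ⟨C, hC⟩ := hZ
  refine ⟨⟨(Z, C + 1), by positivity, fun f hf => (hC f hf).2.trans ?_⟩, rfl⟩
  gcongr
  exact le_self_add

/-- Weights `C⁻¹` make `S` bounded with constant `1` into the supremum space, while each admissible
`‖·‖_Z` is at most `C` times the supremum. The Marcinkiewicz space shows that the family is
nonempty. -/
theorem QuasiConcave.exists_isOptimalRange {φ : ℝ → ℝ} (hφ : QuasiConcave φ)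
    (h : ∃ C : ℝ, 0 < C ∧ ∀ t : ℝ, 0 < t → C * t * Real.log (1 + 1 / t) ≤ φ t) :
    ∃ Y : RISpace, IsOptimalRange hφ Y := by
  have : Nonempty hφ.HardyTarget :=
    ⟨(hφ.hardyBounded_auxMarcinkiewicz h).exists_hardyTarget.choose⟩
  have hcancel : ∀ (p : hφ.HardyTarget) (x : ℝ≥0∞),
      ((p.1.2⁻¹ : ℝ≥0) : ℝ≥0∞) * (p.1.2 * x) = x := fun p x => by
    rw [← mul_assoc, ← ENNReal.coe_mul, inv_mul_cancel₀ p.2.1, ENNReal.coe_one, one_mul]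
  refine ⟨RISpace.weightedSup (fun p : hφ.HardyTarget => p.1.1) (fun p => p.1.2⁻¹)
    (fun p => inv_ne_zero p.2.1) (fun E hE hEt => ?_),
    ⟨1, fun f hf => ⟨fun t ht => hφ.intervalIntegrable_of_mem_lorentzSpace h hf ht, ?_⟩⟩,
    fun Z hZ f hf => ⟨hf.1, ?_⟩⟩
  · set m := max 1 (halfLine E).toReal
    have hm : 0 < m := lt_max_of_lt_left one_pos
    refine lt_of_le_of_lt (iSup_le fun p => ?_)
      -- The upper bound for the fundamental function with `t = r = m`, divided by the constant of
      -- the pair.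
      (ENNReal.ofReal_lt_top (r := 4 * (m * φ m / (m * Real.log (1 + m / m)))))
    have h1 := (p.1.1.norm_indicator_le hE hEt (le_max_right _ _)).trans
      (HardyBounded.norm_indicator_le p.2.2 hm hm)
    rw [mul_comm 4 (p.1.2 : ℝ), mul_assoc, ENNReal.ofReal_mul p.1.2.coe_nonneg,
      ENNReal.ofReal_coe_nnreal] at h1
    exact (mul_le_mul_right h1 _).trans (hcancel p _).le
  · rw [ENNReal.coe_one, one_mul]
    exact iSup_le fun p => (mul_le_mul_right (p.2.2 f hf) _).trans (hcancel p _).le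
  · obtain ⟨p, rfl⟩ := hZ.exists_hardyTarget
    have h1 : ((p.1.2⁻¹ : ℝ≥0) : ℝ≥0∞) * p.1.1.norm (fun t => ‖f t‖ₑ) < ∞ :=
      lt_of_le_of_lt (le_iSup (fun p : hφ.HardyTarget =>
        ((p.1.2⁻¹ : ℝ≥0) : ℝ≥0∞) * p.1.1.norm (fun t => ‖f t‖ₑ)) p) hf.2
    exact ENNReal.lt_top_of_mul_ne_top_right h1.ne (by simpa using p.2.1)

end

theorem proposition4p6 (φ : ℝ → ℝ) (hφ : QuasiConcave φ)
    (h : ∃ C : ℝ, 0 < C ∧ ∀ t : ℝ, 0 < t → C * t * Real.log (1 + 1 / t) ≤ φ t) :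
    (∃ Y : RISpace, IsOptimalRange hφ Y) ∧
      ∀ Y : RISpace, IsOptimalRange hφ Y →
        ∃ c C : ℝ, 0 < c ∧ 0 < C ∧ ∀ t : ℝ, 0 < t →
          c * auxFunction φ t ≤ Y.fundamentalFunction t ∧
            Y.fundamentalFunction t ≤ C * auxFunction φ t := by
  refine ⟨hφ.exists_isOptimalRange h, fun Y hY => ?_⟩
  obtain ⟨C, hC⟩ := hY.1
  obtain ⟨D, hD⟩ :=
    RISpace.exists_norm_le_of_carrier_subset (hY.2 _ (hφ.hardyBounded_auxMarcinkiewicz h))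
  -- Adding `1` keeps both constants positive, since `C` and `D` may vanish.
  refine ⟨((D : ℝ) + 1)⁻¹, 4 * (C + 1), by positivity, by positivity, fun t ht => ?_⟩
  have hspec := Y.fundamentalFunction_spec t _ measurableSet_Ioo (halfLine_Ioo_zero t)
  have hY0 : 0 ≤ Y.fundamentalFunction t := ENNReal.toReal_nonneg
  have hpos := auxFunction_pos h ht
  constructor
  · have h1 := (hφ.auxFunction_le_auxMarcinkiewicz_norm h ht).trans
      (hD _ (measurable_const.indicator measurableSet_Ioo).aemeasurable)
    rw [hspec, ← ENNReal.ofReal_coe_nnreal, ← ENNReal.ofReal_mul D.coe_nonneg,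
      ENNReal.ofReal_le_ofReal_iff (by positivity)] at h1
    rw [inv_mul_le_iff₀ (by positivity)]
    linarith
  · rw [← div_le_iff₀' (by positivity)]
    refine le_auxFunction fun r hr => ?_
    have hterm := auxFunction_term_pos hφ ht hr
    have h2 := HardyBounded.norm_indicator_le (fun f hf => (hC f hf).2) ht hr
    rw [hspec, ENNReal.ofReal_le_ofReal_iff (by positivity)] at h2
    rw [div_le_iff₀' (by positivity)]
    exact h2.trans (by gcongr; linarith)
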